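/- **Setting.** Let $n,N\ge 1$, let $a,b$ be vectors in the probability simplex $\Delta^n$ with all entries positive, let $C^1,\dots,C^N\in\mathbb R^{n\times n}$ be cost matrices (of arbitrary sign) with $c_\infty:=\max_{k,i,j}|C^k_{ij}|>0$, let $\epsilon>0$, $\theta\in(0,1)$ and $\iota:=\min_j\log b_j$. For a matrix $\pi$ let $r(\pi)=\pi\mathbf 1$, $c(\pi)=\pi^\top\mathbf 1$. Let $\Pi^N_{a,b}$ be the set of $\boldsymbol\pi=(\pi^k)_{k=1}^N$ with entrywise nonnegative $\pi^k\in\mathbb R^{n\times n}$, $r(\sum_k\pi^k)=a$, $c(\sum_k\pi^k)=b$, and $\ell(\boldsymbol\pi,\lambda)=\sum_k\lambda_k\langle\pi^k,C^k\rangle$. The EOT problem is $\min_{\boldsymbol\pi\in\Pi^N_{a,b}}\max_{\lambda\in\Delta^N}\ell(\boldsymbol\pi,\lambda)$; a pair $(\hat{\boldsymbol\pi},\hat\lambda)\in\Pi^N_{a,b}\times\Delta^N$ is $\epsilon$-optimal (an $\epsilon$-saddle point) if $\max_{\lambda\in\Delta^N}\ell(\hat{\boldsymbol\pi},\lambda)-\min_{\boldsymbol\pi\in\Pi^N_{a,b}}\ell(\boldsymbol\pi,\hat\lambda)\le\epsilon$.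 Put $\eta=\min\{\epsilon/(3(\log(n^2N)+1)),c_\infty\}$, $\tau=\eta/(2c_\infty^2)$, $\zeta^k(f,g,\lambda)_{ij}=\exp((f_i+g_j-\lambda_kC^k_{ij})/\eta)$, $\pi^k(f,g,\lambda)=\zeta^k(f,g,\lambda)/\sum_l\|\zeta^l(f,g,\lambda)\|_1$, $$F(f,g,\lambda)=\langle f,a\rangle+\langle g,b\rangle-\eta\log\Big(\sum_k\|\zeta^k(f,g,\lambda)\|_1\Big)-\eta ,$$ $F^*=\sup\{F(f,g,\lambda):f,g\in\mathbb R^n,\lambda\in\Delta^N\}$ and $\tilde F=F^*-F$. **Algorithm (PAME).** Start with $f^0=g^0=(1,\dots,1)$, $\lambda^{-1}=\lambda^0=(1/N,\dots,1/N)$ and iterate, for $t\ge0$ (logarithms and quotients of vectors are entrywise), $$f^{t+1}=f^t+\eta\log\frac{a}{r(\sum_k\zeta^k(f^t,g^t,\lambda^t))},\qquad g^{t+1}=g^t+\eta\log\frac{b}{c(\sum_k\zeta^k(f^{t+1},g^t,\lambda^t))},$$ $$y^{t+1}=\mathrm{Proj}_{\Delta^N}\big(\lambda^t+(1-\theta)(\lambda^t-\lambda^{t-1})\big),\qquad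 \lambda^{t+1}=\mathrm{Proj}_{\Delta^N}\big(y^{t+1}+\tau\nabla_\lambda F(f^{t+1},g^{t+1},y^{t+1})\big).$$ With $\tilde{\boldsymbol\pi}_T:=(\pi^k(f^T,g^{T-1},\lambda^{T-1}))_k$, the stopping conditions at iteration $T\ge1$ are $$\Big\|c\Big(\sum_k\tilde\pi_T^k\Big)-b\Big\|_1\le\frac{\epsilon}{6(6c_\infty-\eta\iota)},\quad \|\lambda^{T-1}-\lambda^{T-2}\|_2\le\frac{\eta\epsilon}{60(1-\theta)c_\infty^2},\quad \|\lambda^T-y^T\|_2\le\frac{\eta\epsilon}{42c_\infty^2},\quad \tilde F(f^T,g^{T-1},\lambda^{T-1})\le\frac\epsilon6 .$$ The output at iteration $T$ is $(\hat{\boldsymbol\pi},\lambda^{T-1})$, where $\hat\pi^k=\mathrm{Round}(\tilde\pi_T^k,a^k,b^k)$ and $(a^k,b^k)_k$ are margins of $\tilde{\boldsymbol\pi}_T$: $a^k=r(\tilde\pi_T^k)$, and the $b^k\ge0$ satisfy $\sum_kb^k=b$, $\sum_ia^k_i=\sum_jb^k_j$, and $(b^k_j-c(\tilde\pi_T^k)_j)(b^{k'}_j-c(\tilde\pi_T^{k'})_j)\ge0$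 for all $j,k,k'$. $\mathrm{Round}(\pi,p,q)$ multiplies row $i$ of $\pi$ by $\min\{p_i/r(\pi)_i,1\}$ to get $\pi'$, then column $j$ of $\pi'$ by $\min\{q_j/c(\pi')_j,1\}$ to get $\pi''$, and returns $\pi''+e_pe_q^\top/\|e_p\|_1$ with $e_p=p-r(\pi'')$, $e_q=q-c(\pi'')$ (just $\pi''$ if $e_p=0$). **Theorem.** Let $$\gamma_1=\min\Big\{\frac1{(2c_\infty-\eta\iota)^2},\ \frac{2(2\theta-\theta^2)}{(7-5\theta)^2c_\infty^2},\ \frac1{49c_\infty^2}\Big\},\qquad \epsilon'=\frac{\epsilon}{6c_\infty-\eta\iota},$$ $$\bar T=8+\frac{48}{\eta\sqrt{\gamma_1}\,\epsilon'}+\frac{(3600(1-\theta)^2+882)\,c_\infty^2}{\eta\epsilon}+\frac{48}{\eta\gamma_1\epsilon}.$$ 1. There is a constant $K$ depending only on $n,N,b,\theta$ with $\gamma_1\le K/c_\infty^2$, and $\bar T\le Kc_\infty^2/\epsilon^2$ whenever $\epsilon\le c_\infty$; that is, $\gamma_1=O(c_\infty^{-2})$ and $\bar T=O(c_\infty^2\epsilon^{-2})$.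 2. The stopping conditions hold at some iteration $T$ with $1\le T\le\bar T$. 3. At every iteration $T$ at which the stopping conditions hold, margins as above exist, and for every choice of such margins the output $(\hat{\boldsymbol\pi},\lambda^{T-1})$ is an $\epsilon$-optimal solution of the EOT problem. 4. The Hamiltonian $E_t:=F(f^t,g^t,\lambda^t)-\frac1{2\tau}\|\lambda^t-\lambda^{t-1}\|_2^2$ is nondecreasing in $t\ge0$, and for all $t\ge0$ $$F^*-E_{t+1}\le\frac{6/(\eta\gamma_1)}{t+1+6/(\eta\gamma_1\tilde F(f^0,g^0,\lambda^0))}$$ (if $\tilde F(f^0,g^0,\lambda^0)=0$, the second term of the denominator is read as $0$). -/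

import Mathlib

open scoped BigOperators

namespace EOT

/-! ### The equitable optimal transport (EOT) problem -/

/-- Row sums `r(π) = π 1`. -/
def rowSum {n : ℕ} (π : Matrix (Fin n) (Fin n) ℝ) (i : Fin n) : ℝ := ∑ j, π i j

/-- Column sums `c(π) = πᵀ 1`. -/
def colSum {n : ℕ} (π : Matrix (Fin n) (Fin n) ℝ) (j : Fin n) : ℝ := ∑ i, π i j

/-- Frobenius inner product `⟨π, C⟩`. -/
def frob {n : ℕ} (π C : Matrix (Fin n) (Fin n) ℝ) : ℝ := ∑ i, ∑ j, π i j * C i j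

/-- The `ℓ₁` norm of a vector. -/
def l1 {n : ℕ} (v : Fin n → ℝ) : ℝ := ∑ i, |v i|

/-- The probability simplex `Δ^N`, inside Euclidean space. -/
def simplex (N : ℕ) : Set (EuclideanSpace ℝ (Fin N)) :=
  {x | (fun k => x k) ∈ stdSimplex ℝ (Fin N)}

/-- The coupling decomposition set `Π_{a,b}^N`. -/
def couplings {n : ℕ} (N : ℕ) (a b : Fin n → ℝ) : Set (Fin N → Matrix (Fin n) (Fin n) ℝ) :=
  {π | rowSum (∑ k, π k) = a ∧ colSum (∑ k, π k) = b ∧ ∀ k i j, 0 ≤ π k i j}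

/-- The saddle objective `ℓ(π, λ) = ∑ₖ λₖ ⟨πᵏ, Cᵏ⟩`. -/
def ell {n N : ℕ} (C π : Fin N → Matrix (Fin n) (Fin n) ℝ)
    (lam : EuclideanSpace ℝ (Fin N)) : ℝ :=
  ∑ k, lam k * frob (π k) (C k)

/-- `(π, λ) ∈ Π_{a,b}^N × Δ^N` is an `ε`-optimal (`ε`-saddle) solution of the EOT problem: the
duality gap `max_{μ ∈ Δ^N} ℓ(π, μ) - min_{ρ ∈ Π_{a,b}^N} ℓ(ρ, λ)` is at most `ε`. -/
def IsEpsOptimal {n N : ℕ} (C : Fin N → Matrix (Fin n) (Fin n) ℝ) (a b : Fin n → ℝ) (ε : ℝ)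
    (π : Fin N → Matrix (Fin n) (Fin n) ℝ) (lam : EuclideanSpace ℝ (Fin N)) : Prop :=
  π ∈ couplings N a b ∧ lam ∈ simplex N ∧
    ∃ M m : ℝ, IsGreatest ((fun μ => ell C π μ) '' simplex N) M ∧
      IsLeast ((fun ρ => ell C ρ lam) '' couplings N a b) m ∧ M - m ≤ ε

/-! ### Constants -/

/-- `c_∞ = max_k ‖Cᵏ‖_∞`, the largest modulus of an entry of the cost matrices. -/
noncomputable def cInf {n N : ℕ} (C : Fin N → Matrix (Fin n) (Fin n) ℝ) : ℝ :=
  ⨆ k, ⨆ i, ⨆ j, |C k i j|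

/-- `ι = min_j log b_j`. -/
noncomputable def iota {n : ℕ} (b : Fin n → ℝ) : ℝ := ⨅ j, Real.log (b j)

/-- The regularization parameter `η = min {ε / (3 (log (n² N) + 1)), c_∞}`. -/
noncomputable def eta {n N : ℕ} (C : Fin N → Matrix (Fin n) (Fin n) ℝ) (ε : ℝ) : ℝ :=
  min (ε / (3 * (Real.log ((n : ℝ) ^ 2 * (N : ℝ)) + 1))) (cInf C)

/-- The step size `τ = η / (2 c_∞²)`. -/
noncomputable def tau {n N : ℕ} (C : Fin N → Matrix (Fin n) (Fin n) ℝ) (ε : ℝ) : ℝ :=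
  eta C ε / (2 * cInf C ^ 2)

/-! ### The dual of the entropy regularized problem -/

/-- `ζᵏ(f, g, λ) = exp ((f 1ᵀ + 1 gᵀ - λₖ Cᵏ) / η)`, entrywise. -/
noncomputable def zeta {n N : ℕ} (C : Fin N → Matrix (Fin n) (Fin n) ℝ) (η : ℝ)
    (f g : Fin n → ℝ) (lam : EuclideanSpace ℝ (Fin N)) (k : Fin N) :
    Matrix (Fin n) (Fin n) ℝ :=
  Matrix.of fun i j => Real.exp ((f i + g j - lam k * C k i j) / η)

/-- `∑ₖ ‖ζᵏ(f, g, λ)‖₁`. -/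
noncomputable def zetaMass {n N : ℕ} (C : Fin N → Matrix (Fin n) (Fin n) ℝ) (η : ℝ)
    (f g : Fin n → ℝ) (lam : EuclideanSpace ℝ (Fin N)) : ℝ :=
  ∑ k, ∑ i, ∑ j, |zeta C η f g lam k i j|

/-- `πᵏ(f, g, λ) = ζᵏ(f, g, λ) / ∑ₗ ‖ζˡ(f, g, λ)‖₁`. -/
noncomputable def plan {n N : ℕ} (C : Fin N → Matrix (Fin n) (Fin n) ℝ) (η : ℝ)
    (f g : Fin n → ℝ) (lam : EuclideanSpace ℝ (Fin N)) (k : Fin N) :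
    Matrix (Fin n) (Fin n) ℝ :=
  (zetaMass C η f g lam)⁻¹ • zeta C η f g lam k

/-- The dual objective `F(f, g, λ) = ⟨f, a⟩ + ⟨g, b⟩ - η log (∑ₖ ‖ζᵏ(f, g, λ)‖₁) - η`. -/
noncomputable def dualF {n N : ℕ} (C : Fin N → Matrix (Fin n) (Fin n) ℝ) (a b : Fin n → ℝ)
    (η : ℝ) (f g : Fin n → ℝ) (lam : EuclideanSpace ℝ (Fin N)) : ℝ :=
  ∑ i, f i * a i + ∑ j, g j * b j - η * Real.log (zetaMass C η f g lam) - η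

/-- The values taken by `F` on `ℝⁿ × ℝⁿ × Δ^N`. -/
def dualValues {n N : ℕ} (C : Fin N → Matrix (Fin n) (Fin n) ℝ) (a b : Fin n → ℝ)
    (η : ℝ) : Set ℝ :=
  {v | ∃ (f g : Fin n → ℝ), ∃ lam ∈ simplex N, v = dualF C a b η f g lam}

/-- The optimal value `F* = max F` of the dual problem over `ℝⁿ × ℝⁿ × Δ^N`. -/
noncomputable def dualOpt {n N : ℕ} (C : Fin N → Matrix (Fin n) (Fin n) ℝ) (a b : Fin n → ℝ)
    (η : ℝ) : ℝ :=
  sSup (dualValues C a b η)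

/-- The set whose supremum is `F*` is bounded above, so that the supremum is a genuine one. -/
theorem bddAbove_dualValues {n N : ℕ} (C : Fin N → Matrix (Fin n) (Fin n) ℝ)
    (a b : Fin n → ℝ) (ha : a ∈ stdSimplex ℝ (Fin n)) (hb : b ∈ stdSimplex ℝ (Fin n))
    {η : ℝ} (hη : 0 < η) : BddAbove (dualValues C a b η) := by
  refine ⟨∑ k, |∑ i, ∑ j, a i * b j * C k i j| - η, ?_⟩
  rintro v ⟨f, g, lam, hlam, rfl⟩
  have hl0 : ∀ k, 0 ≤ lam k := fun k => hlam.1 k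
  have hl1 : ∑ k, lam k = 1 := hlam.2
  obtain ⟨k, -⟩ : ∃ k : Fin N, True := by
    by_contra h
    push Not at h
    have : ∑ k, lam k = 0 := Finset.sum_eq_zero fun k _ => (h k).elim
    linarith
  have hlk : lam k ≤ 1 := by
    rw [← hl1]
    exact Finset.single_le_sum (fun k _ => hl0 k) (Finset.mem_univ k)
  have hsingle : ∀ i j, f i + g j - lam k * C k i j ≤
      η * Real.log (zetaMass C η f g lam) := by
    intro i j
    have h1 : Real.exp ((f i + g j - lam k * C k i j) / η) ≤ zetaMass C η f g lam := by
      have e1 : |zeta C η f g lam k i j| ≤ ∑ j, |zeta C η f g lam k i j| :=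
        Finset.single_le_sum (f := fun j => |zeta C η f g lam k i j|)
          (fun _ _ => abs_nonneg _) (Finset.mem_univ j)
      have e2 : ∑ j, |zeta C η f g lam k i j| ≤ ∑ i, ∑ j, |zeta C η f g lam k i j| :=
        Finset.single_le_sum (f := fun i => ∑ j, |zeta C η f g lam k i j|)
          (fun _ _ => Finset.sum_nonneg fun _ _ => abs_nonneg _) (Finset.mem_univ i)
      have e3 : ∑ i, ∑ j, |zeta C η f g lam k i j| ≤ zetaMass C η f g lam :=
        Finset.single_le_sum (f := fun k => ∑ i, ∑ j, |zeta C η f g lam k i j|)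
          (fun _ _ => Finset.sum_nonneg fun _ _ => Finset.sum_nonneg fun _ _ => abs_nonneg _)
          (Finset.mem_univ k)
      have e0 : Real.exp ((f i + g j - lam k * C k i j) / η) ≤ |zeta C η f g lam k i j| :=
        le_abs_self _
      linarith
    have h2 : (f i + g j - lam k * C k i j) / η ≤ Real.log (zetaMass C η f g lam) :=
      (Real.le_log_iff_exp_le (lt_of_lt_of_le (Real.exp_pos _) h1)).2 h1
    rw [div_le_iff₀ hη] at h2
    linarith
  have hsum : ∑ i, ∑ j, a i * b j * (f i + g j - lam k * C k i j) ≤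
      ∑ i, ∑ j, a i * b j * (η * Real.log (zetaMass C η f g lam)) :=
    Finset.sum_le_sum fun i _ => Finset.sum_le_sum fun j _ =>
      mul_le_mul_of_nonneg_left (hsingle i j) (mul_nonneg (ha.1 i) (hb.1 j))
  have hr : ∑ i, ∑ j, a i * b j * (η * Real.log (zetaMass C η f g lam)) =
      η * Real.log (zetaMass C η f g lam) := by
    simp_rw [← Finset.sum_mul, ← Finset.mul_sum]
    rw [hb.2]
    simp [ha.2]
  have hl : ∑ i, ∑ j, a i * b j * (f i + g j - lam k * C k i j) =
      ∑ i, f i * a i + ∑ j, g j * b j - lam k * ∑ i, ∑ j, a i * b j * C k i j := by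
    have e : ∀ i j, a i * b j * (f i + g j - lam k * C k i j) =
        (f i * a i) * b j + a i * (g j * b j) - lam k * (a i * b j * C k i j) := by
      intro i j; ring
    simp_rw [e, Finset.sum_sub_distrib, Finset.sum_add_distrib, ← Finset.mul_sum, hb.2,
      ← Finset.sum_mul, ha.2]
    ring
  have hX : lam k * ∑ i, ∑ j, a i * b j * C k i j ≤ ∑ k, |∑ i, ∑ j, a i * b j * C k i j| := by
    have h1 : |∑ i, ∑ j, a i * b j * C k i j| ≤ ∑ k, |∑ i, ∑ j, a i * b j * C k i j| :=
      Finset.single_le_sum (f := fun k => |∑ i, ∑ j, a i * b j * C k i j|)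
        (fun _ _ => abs_nonneg _) (Finset.mem_univ k)
    have h2 : lam k * ∑ i, ∑ j, a i * b j * C k i j ≤
        lam k * |∑ i, ∑ j, a i * b j * C k i j| :=
      mul_le_mul_of_nonneg_left (le_abs_self _) (hl0 k)
    have h3 : lam k * |∑ i, ∑ j, a i * b j * C k i j| ≤
        1 * |∑ i, ∑ j, a i * b j * C k i j| :=
      mul_le_mul_of_nonneg_right hlk (abs_nonneg _)
    linarith
  unfold dualF
  linarith

/-! ### The iteration with extrapolation (PAME) -/

/-- Euclidean projection onto the simplex `Δ^N`: a point of `Δ^N` nearest to `x`. -/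
noncomputable def projSimplex {N : ℕ} (x : EuclideanSpace ℝ (Fin N)) :
    EuclideanSpace ℝ (Fin N) :=
  Classical.epsilon fun p => p ∈ simplex N ∧ ∀ q ∈ simplex N, ‖x - p‖ ≤ ‖x - q‖

/-- For `N ≥ 1` the projection does return a nearest point of the simplex. -/
theorem projSimplex_spec {N : ℕ} (hN : 0 < N) (x : EuclideanSpace ℝ (Fin N)) :
    projSimplex x ∈ simplex N ∧ ∀ q ∈ simplex N, ‖x - projSimplex x‖ ≤ ‖x - q‖ := by
  have hc : IsCompact (simplex N) := by
    have h := (isCompact_stdSimplex ℝ (Fin N)).image (PiLp.continuous_toLp 2 fun _ : Fin N => ℝ)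
    convert h using 1
    ext y
    constructor
    · intro hy
      exact ⟨fun k => y k, hy, rfl⟩
    · rintro ⟨z, hz, rfl⟩
      exact hz
  have hne : (simplex N).Nonempty :=
    ⟨WithLp.toLp 2 (Pi.single ⟨0, hN⟩ 1), single_mem_stdSimplex ℝ _⟩
  obtain ⟨p, hp, hd⟩ := hc.exists_infDist_eq_dist hne x
  exact Classical.epsilon_spec
    (p := fun p => p ∈ simplex N ∧ ∀ q ∈ simplex N, ‖x - p‖ ≤ ‖x - q‖)
    ⟨p, hp, fun q hq => by
      rw [← dist_eq_norm, ← dist_eq_norm, ← hd]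
      exact Metric.infDist_le_dist_of_mem hq⟩

/-- The variables `(fᵗ, gᵗ, yᵗ, λᵗ)` of the algorithm together with `λᵗ⁻¹`. -/
structure PAMEState (n N : ℕ) where
  f : Fin n → ℝ
  g : Fin n → ℝ
  y : EuclideanSpace ℝ (Fin N)
  lam : EuclideanSpace ℝ (Fin N)
  lamPrev : EuclideanSpace ℝ (Fin N)

/-- `f⁰ = g⁰ = (1, …, 1)` and `λ⁰ = λ⁻¹ = (1/N, …, 1/N)`; the value of `y⁰` is never used. -/
noncomputable def pameInit (n N : ℕ) : PAMEState n N where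
  f := fun _ => 1
  g := fun _ => 1
  y := WithLp.toLp 2 fun _ => 1 / (N : ℝ)
  lam := WithLp.toLp 2 fun _ => 1 / (N : ℝ)
  lamPrev := WithLp.toLp 2 fun _ => 1 / (N : ℝ)

/-- `f⁺ = f + η log (a / r(∑ₖ ζᵏ(f, g, λ)))`. -/
noncomputable def fUpdate {n N : ℕ} (C : Fin N → Matrix (Fin n) (Fin n) ℝ) (a : Fin n → ℝ)
    (η : ℝ) (f g : Fin n → ℝ) (lam : EuclideanSpace ℝ (Fin N)) (i : Fin n) : ℝ :=
  f i + η * Real.log (a i / rowSum (∑ k, zeta C η f g lam k) i)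

/-- `g⁺ = g + η log (b / c(∑ₖ ζᵏ(f, g, λ)))`. -/
noncomputable def gUpdate {n N : ℕ} (C : Fin N → Matrix (Fin n) (Fin n) ℝ) (b : Fin n → ℝ)
    (η : ℝ) (f g : Fin n → ℝ) (lam : EuclideanSpace ℝ (Fin N)) (j : Fin n) : ℝ :=
  g j + η * Real.log (b j / colSum (∑ k, zeta C η f g lam k) j)

/-- One iteration of PAME. -/
noncomputable def pameStep {n N : ℕ} (C : Fin N → Matrix (Fin n) (Fin n) ℝ) (a b : Fin n → ℝ)
    (η τ θ : ℝ) (s : PAMEState n N) : PAMEState n N :=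
  let f' := fUpdate C a η s.f s.g s.lam
  let g' := gUpdate C b η f' s.g s.lam
  let y' := projSimplex (s.lam + (1 - θ) • (s.lam - s.lamPrev))
  let lam' := projSimplex (y' + τ • gradient (fun μ => dualF C a b η f' g' μ) y')
  { f := f', g := g', y := y', lam := lam', lamPrev := s.lam }

/-- The iterates of PAME for accuracy `ε` and extrapolation parameter `θ`. -/
noncomputable def pame {n N : ℕ} (C : Fin N → Matrix (Fin n) (Fin n) ℝ) (a b : Fin n → ℝ)
    (ε θ : ℝ) : ℕ → PAMEState n N
  | 0 => pameInit n N
  | t + 1 => pameStep C a b (eta C ε) (tau C ε) θ (pame C a b ε θ t)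

/-- The plans `πᵏ(f^T, g^{T-1}, λ^{T-1})` for `T = t + 1`. -/
noncomputable def pamePlan {n N : ℕ} (C : Fin N → Matrix (Fin n) (Fin n) ℝ) (a b : Fin n → ℝ)
    (ε θ : ℝ) (t : ℕ) : Fin N → Matrix (Fin n) (Fin n) ℝ :=
  plan C (eta C ε) (pame C a b ε θ (t + 1)).f (pame C a b ε θ t).g (pame C a b ε θ t).lam

/-- The four stopping conditions at iteration `T = t + 1`. -/
def PAMEStop {n N : ℕ} (C : Fin N → Matrix (Fin n) (Fin n) ℝ) (a b : Fin n → ℝ)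
    (ε θ : ℝ) (t : ℕ) : Prop :=
  l1 (colSum (∑ k, pamePlan C a b ε θ t k) - b) ≤
      ε / (6 * (6 * cInf C - eta C ε * iota b)) ∧
  ‖(pame C a b ε θ t).lam - (pame C a b ε θ t).lamPrev‖ ≤
      eta C ε * ε / (60 * (1 - θ) * cInf C ^ 2) ∧
  ‖(pame C a b ε θ (t + 1)).lam - (pame C a b ε θ (t + 1)).y‖ ≤
      eta C ε * ε / (42 * cInf C ^ 2) ∧
  dualOpt C a b (eta C ε) -
      dualF C a b (eta C ε) (pame C a b ε θ (t + 1)).f (pame C a b ε θ t).g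
        (pame C a b ε θ t).lam ≤ ε / 6

/-! ### Margins and rounding -/

/-- `(aᵏ, bᵏ)ₖ` is an admissible result of `Margins(π, a, b)`: `aᵏ = r(πᵏ)`, and the `bᵏ`
satisfy the four properties required of the procedure. -/
def IsMargins {n N : ℕ} (π : Fin N → Matrix (Fin n) (Fin n) ℝ) (b : Fin n → ℝ)
    (A B : Fin N → Fin n → ℝ) : Prop :=
  (∀ k, A k = rowSum (π k)) ∧
  (∀ k j, 0 ≤ B k j) ∧
  (∀ j, ∑ k, B k j = b j) ∧
  (∀ k, ∑ i, A k i = ∑ j, B k j) ∧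
  (∀ j k k', 0 ≤ (B k j - colSum (π k) j) * (B k' j - colSum (π k') j))

/-- `π' = X π` with `X = Diag(x)`, `x_i = min (a_i / r(π)_i) 1`. -/
noncomputable def roundRows {n : ℕ} (π : Matrix (Fin n) (Fin n) ℝ) (a : Fin n → ℝ) :
    Matrix (Fin n) (Fin n) ℝ :=
  Matrix.diagonal (fun i => min (a i / rowSum π i) 1) * π

/-- `π'' = π' Y` with `Y = Diag(y)`, `y_j = min (b_j / c(π')_j) 1`. -/
noncomputable def roundCols {n : ℕ} (π : Matrix (Fin n) (Fin n) ℝ) (b : Fin n → ℝ) :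
    Matrix (Fin n) (Fin n) ℝ :=
  π * Matrix.diagonal (fun j => min (b j / colSum π j) 1)

/-- `Round(π, a, b) = π'' + err_a err_bᵀ / ‖err_a‖₁` (the correction is `0` if `err_a = 0`). -/
noncomputable def round {n : ℕ} (π : Matrix (Fin n) (Fin n) ℝ) (a b : Fin n → ℝ) :
    Matrix (Fin n) (Fin n) ℝ :=
  let π'' := roundCols (roundRows π a) b
  let errA := a - rowSum π''
  let errB := b - colSum π''
  π'' + (l1 errA)⁻¹ • Matrix.vecMulVec errA errB

/-! ### The iteration bound and the Hamiltonian -/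

/-- `γ₁ = min {1/(2c_∞ - ηι)², 2(2θ - θ²)/((7 - 5θ)² c_∞²), 1/(49 c_∞²)}`. -/
noncomputable def gamma1 {n N : ℕ} (C : Fin N → Matrix (Fin n) (Fin n) ℝ) (b : Fin n → ℝ)
    (ε θ : ℝ) : ℝ :=
  min (1 / (2 * cInf C - eta C ε * iota b) ^ 2)
    (min (2 * (2 * θ - θ ^ 2) / ((7 - 5 * θ) ^ 2 * cInf C ^ 2)) (1 / (49 * cInf C ^ 2)))

/-- `ε' = ε / (6c_∞ - ηι)`. -/
noncomputable def epsPrime {n N : ℕ} (C : Fin N → Matrix (Fin n) (Fin n) ℝ) (b : Fin n → ℝ)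
    (ε : ℝ) : ℝ :=
  ε / (6 * cInf C - eta C ε * iota b)

/-- The iteration bound
`T = 8 + 48/(η√γ₁ ε') + (3600(1-θ)² + 882) c_∞²/(ηε) + 48/(ηγ₁ε)`. -/
noncomputable def iterBound {n N : ℕ} (C : Fin N → Matrix (Fin n) (Fin n) ℝ) (b : Fin n → ℝ)
    (ε θ : ℝ) : ℝ :=
  8 + 48 / (eta C ε * Real.sqrt (gamma1 C b ε θ) * epsPrime C b ε)
    + (3600 * (1 - θ) ^ 2 + 882) * cInf C ^ 2 / (eta C ε * ε)
    + 48 / (eta C ε * gamma1 C b ε θ * ε)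

/-- The Hamiltonian `E(fᵗ, gᵗ, λᵗ, λᵗ⁻¹) = F(fᵗ, gᵗ, λᵗ) - ‖λᵗ - λᵗ⁻¹‖²/(2τ)` along PAME. -/
noncomputable def hamiltonian {n N : ℕ} (C : Fin N → Matrix (Fin n) (Fin n) ℝ)
    (a b : Fin n → ℝ) (ε θ : ℝ) (t : ℕ) : ℝ :=
  dualF C a b (eta C ε) (pame C a b ε θ t).f (pame C a b ε θ t).g (pame C a b ε θ t).lam
    - ‖(pame C a b ε θ t).lam - (pame C a b ε θ t).lamPrev‖ ^ 2 / (2 * tau C ε)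

end EOT

/-! The dual function `F` is linear minus `η` times a log-sum-exp, so passing from one dual point to
another reweights the plan exponentially. Jensen's inequality then gives concavity (`dualF_sub_le`),
and Hoeffding's lemma gives smoothness in the sup norm of the change of exponent (`le_dualF_sub`).

Write `δ t` for `F*` minus the Hamiltonian, and let `A`, `B`, `G` be the column violation, the last
step in `λ`, and the projected gradient step. The updates of `f` and `g` are exact block
maximisations, and the step in `λ` is a proximal gradient step from an extrapolated point. The
penalty in the Hamiltonian pays for the extrapolation, so each iteration lowers `δ` by a positive
quadratic form in `A`, `B`, `G` (`hamGap_sub_ge`). Concavity at the half step bounds `δ (t + 1)` by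
a linear form in the same errors (`hamGap_succ_le`). By Cauchy–Schwarz, `δ t * δ (t + 1) ≤ W * (δ t
- δ (t + 1))` with `W ≤ 6 / (η γ₁)` (`hamGap_mul_le`). Hence `1 / δ` grows by at least `1 / W` per
step, which is the rate.

For the stopping time, the rate first brings `δ` below `ε / 6`, which already forces the fourth
condition. From then on, an iteration that violates another condition lowers `δ` by an amount of
order `η γ₁ ε²` (`decrease_of_not_pameStop`), which can happen only boundedly often because `δ ≥ 0`
(`exists_le_of_recursion`).

For optimality, the half-step plan has the correct rows, and rounding along sign-consistent margins
moves it by at most `A` in `ℓ₁`. The duality gap is then the rounding cost, plus the first-order gap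
in `λ`, plus a primal-dual gap at fixed `λ`. The last is controlled by weak duality for the
potentials and by the entropy bound `log (n² N)` (`saddle_gap_le`). -/

namespace EOT

/-! ### Exponential tilts of a finite probability weight -/

section Exponential

variable {ι : Type*} [Fintype ι]

theorem exp_sum_mul_le_sum_mul_exp {p x : ι → ℝ} (hp : ∀ i, 0 ≤ p i) (hp1 : ∑ i, p i = 1) :
    Real.exp (∑ i, p i * x i) ≤ ∑ i, p i * Real.exp (x i) := by
  have h := convexOn_exp.map_sum_le (t := Finset.univ) (w := p) (p := x) (fun i _ => hp i) hp1
    (fun i _ => Set.mem_univ _)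
  simpa using h

/-- The covariance is the mean of `(x - m) w`, so it is at most `W` times the mean absolute
deviation `d` of `x`. Nonnegativity of the variance of `|x - m|` gives `d² ≤ E x² - m² ≤ V²`.
Bounding `|x - m|` pointwise would lose a factor `2`. -/
theorem abs_cov_le {q x w : ι → ℝ} {V W : ℝ} (hq : ∀ i, 0 ≤ q i) (hq1 : ∑ i, q i = 1)
    (hV : 0 ≤ V) (hx : ∀ i, |x i| ≤ V) (hw : ∀ i, |w i| ≤ W) :
    |∑ i, q i * x i * w i - (∑ i, q i * x i) * ∑ i, q i * w i| ≤ V * W := by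
  set m := ∑ i, q i * x i with hm
  set d := ∑ i, q i * |x i - m| with hd
  have hd0 : 0 ≤ d := Finset.sum_nonneg fun i _ => mul_nonneg (hq i) (abs_nonneg _)
  have e1 : ∑ i, q i * (|x i - m| - d) ^ 2 = ∑ i, q i * x i ^ 2 - m ^ 2 - d ^ 2 := by
    have : ∀ i, q i * (|x i - m| - d) ^ 2 = q i * x i ^ 2 - 2 * m * (q i * x i) + m ^ 2 * q i
        - 2 * d * (q i * |x i - m|) + d ^ 2 * q i := by
      intro i
      have := sq_abs (x i - m)
      linear_combination q i * this
    simp_rw [this, Finset.sum_add_distrib, Finset.sum_sub_distrib, Finset.sum_add_distrib,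
      Finset.sum_sub_distrib, ← Finset.mul_sum, hq1, ← hm, ← hd]
    ring
  have e2 : 0 ≤ ∑ i, q i * (|x i - m| - d) ^ 2 :=
    Finset.sum_nonneg fun i _ => mul_nonneg (hq i) (sq_nonneg _)
  have e3 : ∑ i, q i * x i ^ 2 ≤ ∑ i, q i * V ^ 2 :=
    Finset.sum_le_sum fun i _ => mul_le_mul_of_nonneg_left (sq_le_sq.2 (by
      rw [abs_of_nonneg hV]; exact hx i)) (hq i)
  rw [← Finset.sum_mul, hq1, one_mul] at e3
  have hdV : d ≤ V := abs_le_of_sq_le_sq' (by nlinarith [sq_nonneg m]) hV |>.2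
  have e4 : ∑ i, q i * x i * w i - m * ∑ i, q i * w i = ∑ i, q i * (x i - m) * w i := by
    rw [Finset.mul_sum, ← Finset.sum_sub_distrib]
    exact Finset.sum_congr rfl fun i _ => by ring
  rw [e4]
  by_cases hι : IsEmpty ι
  · simp at hq1
  have hW : 0 ≤ W := by
    obtain ⟨i⟩ := not_isEmpty_iff.1 hι
    exact (abs_nonneg _).trans (hw i)
  calc |∑ i, q i * (x i - m) * w i| ≤ ∑ i, |q i * (x i - m) * w i| :=
        Finset.abs_sum_le_sum_abs _ _
    _ ≤ ∑ i, q i * |x i - m| * W := Finset.sum_le_sum fun i _ => by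
        rw [abs_mul, abs_mul, abs_of_nonneg (hq i)]
        exact mul_le_mul_of_nonneg_left (hw i) (mul_nonneg (hq i) (abs_nonneg _))
    _ = d * W := by rw [← Finset.sum_mul]
    _ ≤ V * W := mul_le_mul_of_nonneg_right hdV hW

theorem sum_mul_exp_pos {p : ι → ℝ} (hp : ∀ i, 0 ≤ p i) (hp1 : ∑ i, p i = 1) (x : ι → ℝ) :
    0 < ∑ i, p i * Real.exp (x i) :=
  (Real.exp_pos _).trans_le (exp_sum_mul_le_sum_mul_exp hp hp1)

theorem hasDerivAt_sum_mul_exp (p x w : ι → ℝ) (s : ℝ) :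
    HasDerivAt (fun s : ℝ => ∑ i, p i * Real.exp (s * x i) * w i)
      (∑ i, p i * Real.exp (s * x i) * x i * w i) s := by
  have h : ∀ i ∈ Finset.univ, HasDerivAt (fun s : ℝ => p i * Real.exp (s * x i) * w i)
      (p i * Real.exp (s * x i) * x i * w i) s := by
    intro i _
    have h1 : HasDerivAt (fun s : ℝ => s * x i) (1 * x i) s := (hasDerivAt_id s).mul_const (x i)
    have h2 := (h1.exp.const_mul (p i)).mul_const (w i)
    exact h2.congr_deriv (by ring)
  have := HasDerivAt.fun_sum h
  exact this

/-- The mean of `w` under the exponential tilt of `p` by `x` differs from the mean under `p` by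
at most `sup |x| * sup |w|`. -/
theorem abs_tilted_mean_sub_le {p x w : ι → ℝ} {V W : ℝ} (hp : ∀ i, 0 ≤ p i)
    (hp1 : ∑ i, p i = 1) (hV : 0 ≤ V) (hx : ∀ i, |x i| ≤ V) (hw : ∀ i, |w i| ≤ W) :
    |(∑ i, p i * Real.exp (x i) * w i) / (∑ i, p i * Real.exp (x i)) - ∑ i, p i * w i|
      ≤ V * W := by
  have hZpos : ∀ s : ℝ, 0 < ∑ i, p i * Real.exp (s * x i) := fun s =>
    sum_mul_exp_pos hp hp1 _
  have hZ : ∀ s : ℝ, HasDerivAt (fun s : ℝ => ∑ i, p i * Real.exp (s * x i))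
      (∑ i, p i * Real.exp (s * x i) * x i) s := by
    intro s
    simpa using hasDerivAt_sum_mul_exp p x (fun _ => 1) s
  have hM : ∀ s : ℝ, HasDerivAt (fun s : ℝ => (∑ i, p i * Real.exp (s * x i) * w i) /
      ∑ i, p i * Real.exp (s * x i)) _ s := fun s =>
    (hasDerivAt_sum_mul_exp p x w s).div (hZ s) (hZpos s).ne'
  -- Tilt by `s x` and let `s` run from `0` to `1`: the derivative of the tilted mean of `w` is the
  -- covariance of `x` and `w` under the tilted weight.
  have hb := Convex.norm_image_sub_le_of_norm_hasDerivWithin_le (s := Set.univ) (C := V * W)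
    (x := (0 : ℝ)) (y := 1) (fun s _ => (hM s).hasDerivWithinAt) (fun s _ => by
      have hz := hZpos s
      set Z := ∑ i, p i * Real.exp (s * x i) with hZdef
      have hq := abs_cov_le (q := fun i => p i * Real.exp (s * x i) / Z)
        (fun i => div_nonneg (mul_nonneg (hp i) (Real.exp_pos _).le) hz.le)
        (by rw [← Finset.sum_div, div_self hz.ne']) hV hx hw
      rw [Real.norm_eq_abs]
      refine le_of_eq_of_le (congrArg _ ?_) hq
      have e : ∀ v : ι → ℝ, ∑ i, p i * Real.exp (s * x i) / Z * v i =
          (∑ i, p i * Real.exp (s * x i) * v i) / Z := by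
        intro v
        rw [Finset.sum_div]
        exact Finset.sum_congr rfl fun i _ => by ring
      have e' : ∑ i, p i * Real.exp (s * x i) / Z * x i * w i =
          (∑ i, p i * Real.exp (s * x i) * x i * w i) / Z := by
        rw [Finset.sum_div]
        exact Finset.sum_congr rfl fun i _ => by ring
      rw [e, e, e']
      field_simp) convex_univ (Set.mem_univ _) (Set.mem_univ _)
  simpa [hp1] using hb

/-- Hoeffding's lemma for a finitely supported weight. -/
theorem sum_mul_exp_le {p x : ι → ℝ} {V : ℝ} (hp : ∀ i, 0 ≤ p i)
    (hp1 : ∑ i, p i = 1) (hV : 0 ≤ V) (hx : ∀ i, |x i| ≤ V) :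
    ∑ i, p i * Real.exp (x i) ≤ Real.exp (∑ i, p i * x i + V ^ 2 / 2) := by
  have hZpos : ∀ s : ℝ, 0 < ∑ i, p i * Real.exp (s * x i) := fun s =>
    sum_mul_exp_pos hp hp1 _
  have hZ : ∀ s : ℝ, HasDerivAt (fun s : ℝ => ∑ i, p i * Real.exp (s * x i))
      (∑ i, p i * Real.exp (s * x i) * x i) s := by
    intro s
    simpa using hasDerivAt_sum_mul_exp p x (fun _ => 1) s
  set m := ∑ i, p i * x i with hm
  have hg : ∀ s : ℝ, HasDerivAt (fun s : ℝ => Real.log (∑ i, p i * Real.exp (s * x i)) -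
      (s * m + s ^ 2 * (V ^ 2 / 2)))
      ((∑ i, p i * Real.exp (s * x i) * x i) / (∑ i, p i * Real.exp (s * x i)) -
        (1 * m + (2 * s) * (V ^ 2 / 2))) s := by
    intro s
    refine ((hZ s).log (hZpos s).ne').sub (((hasDerivAt_id s).mul_const m).add ?_)
    have := (hasDerivAt_pow 2 s).mul_const (V ^ 2 / 2)
    simpa using this
  -- The derivative is the mean of `x` tilted by `s x`, minus `m + s V²`. The previous lemma bounds
  -- the change of the mean by `(s V) V`.
  have hanti : AntitoneOn (fun s : ℝ => Real.log (∑ i, p i * Real.exp (s * x i)) -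
      (s * m + s ^ 2 * (V ^ 2 / 2))) (Set.Icc 0 1) := by
    refine antitoneOn_of_deriv_nonpos (convex_Icc 0 1)
      (fun s _ => (hg s).continuousAt.continuousWithinAt)
      (fun s _ => (hg s).differentiableAt.differentiableWithinAt) ?_
    intro s hs
    rw [interior_Icc] at hs
    rw [(hg s).deriv]
    have h := abs_tilted_mean_sub_le (x := fun i => s * x i) (V := s * V) hp hp1
      (mul_nonneg hs.1.le hV) (fun i => by
        rw [abs_mul, abs_of_pos hs.1]
        exact mul_le_mul_of_nonneg_left (hx i) hs.1.le) hx
    have h' := (abs_le.1 h).2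
    rw [← hm] at h'
    nlinarith
  have h := hanti (Set.left_mem_Icc.2 zero_le_one) (Set.right_mem_Icc.2 zero_le_one) zero_le_one
  simp only [one_mul, one_pow, zero_mul, Real.exp_zero, mul_one, hp1, Real.log_one] at h
  have hpos := hZpos 1
  simp only [one_mul] at hpos
  rw [← Real.log_le_iff_le_exp hpos]
  norm_num at h
  linarith

end Exponential

end EOT

namespace EOT

/-! ### Concavity, smoothness and `λ`-gradient of the dual function -/

section Dual

variable {n N : ℕ} {C : Fin N → Matrix (Fin n) (Fin n) ℝ} {a b : Fin n → ℝ} {η c : ℝ}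
  {f g f' g' : Fin n → ℝ} {lam lam' : EuclideanSpace ℝ (Fin N)}

theorem rowSum_sum (P : Fin N → Matrix (Fin n) (Fin n) ℝ) (i : Fin n) :
    rowSum (∑ k, P k) i = ∑ k, rowSum (P k) i := by
  simp only [rowSum, Matrix.sum_apply]
  exact Finset.sum_comm

theorem colSum_sum (P : Fin N → Matrix (Fin n) (Fin n) ℝ) (j : Fin n) :
    colSum (∑ k, P k) j = ∑ k, colSum (P k) j := by
  simp only [colSum, Matrix.sum_apply]
  exact Finset.sum_comm

theorem sum_rowSum (P : Matrix (Fin n) (Fin n) ℝ) : ∑ i, rowSum P i = ∑ i, ∑ j, P i j := rfl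

theorem sum_colSum (P : Matrix (Fin n) (Fin n) ℝ) : ∑ j, colSum P j = ∑ i, ∑ j, P i j :=
  Finset.sum_comm

theorem zeta_pos (k : Fin N) (i j : Fin n) : 0 < zeta C η f g lam k i j := Real.exp_pos _

theorem zetaMass_eq : zetaMass C η f g lam = ∑ k, ∑ i, ∑ j, zeta C η f g lam k i j := by
  simp only [zetaMass, abs_of_pos (zeta_pos _ _ _)]

theorem zetaMass_eq_sum_rowSum :
    zetaMass C η f g lam = ∑ i, rowSum (∑ k, zeta C η f g lam k) i := by
  rw [zetaMass_eq]
  simp_rw [rowSum_sum]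
  rw [Finset.sum_comm]
  rfl

theorem zetaMass_eq_sum_colSum :
    zetaMass C η f g lam = ∑ j, colSum (∑ k, zeta C η f g lam k) j := by
  rw [zetaMass_eq]
  simp_rw [colSum_sum]
  rw [Finset.sum_comm (f := fun j k => colSum (zeta C η f g lam k) j)]
  exact Finset.sum_congr rfl fun k _ => (sum_colSum _).symm

theorem zetaMass_pos [NeZero n] [NeZero N] : 0 < zetaMass C η f g lam := by
  rw [zetaMass_eq]
  exact Finset.sum_pos (fun k _ => Finset.sum_pos (fun i _ => Finset.sum_pos
    (fun j _ => zeta_pos k i j) Finset.univ_nonempty) Finset.univ_nonempty) Finset.univ_nonempty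

theorem plan_apply (k : Fin N) (i j : Fin n) :
    plan C η f g lam k i j = (zetaMass C η f g lam)⁻¹ * zeta C η f g lam k i j := rfl

theorem plan_pos [NeZero n] [NeZero N] (k : Fin N) (i j : Fin n) :
    0 < plan C η f g lam k i j :=
  mul_pos (inv_pos.2 zetaMass_pos) (zeta_pos k i j)

theorem sum_prod3 (F : Fin N → Fin n → Fin n → ℝ) :
    ∑ m : Fin N × Fin n × Fin n, F m.1 m.2.1 m.2.2 = ∑ k, ∑ i, ∑ j, F k i j := by
  simp only [Fintype.sum_prod_type]

/-- The plan as a weight on triples `(k, i, j)`. -/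
noncomputable def planWeight (C : Fin N → Matrix (Fin n) (Fin n) ℝ) (η : ℝ) (f g : Fin n → ℝ)
    (lam : EuclideanSpace ℝ (Fin N)) (m : Fin N × Fin n × Fin n) : ℝ :=
  plan C η f g lam m.1 m.2.1 m.2.2

theorem planWeight_pos [NeZero n] [NeZero N] (m : Fin N × Fin n × Fin n) :
    0 < planWeight C η f g lam m := plan_pos _ _ _

theorem sum_planWeight [NeZero n] [NeZero N] : ∑ m, planWeight C η f g lam m = 1 := by
  simp only [planWeight]
  rw [sum_prod3 (fun k i j => plan C η f g lam k i j)]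
  simp_rw [plan_apply, ← Finset.mul_sum]
  rw [← zetaMass_eq]
  exact inv_mul_cancel₀ zetaMass_pos.ne'

/-- The change of the exponent of `ζ` between two dual points. -/
noncomputable def expoDiff (C : Fin N → Matrix (Fin n) (Fin n) ℝ) (η : ℝ) (u v : Fin n → ℝ)
    (w : EuclideanSpace ℝ (Fin N)) (m : Fin N × Fin n × Fin n) : ℝ :=
  (u m.2.1 + v m.2.2 - w m.1 * C m.1 m.2.1 m.2.2) / η

theorem zeta_eq_mul_exp (k : Fin N) (i j : Fin n) :
    zeta C η f' g' lam' k i j = zeta C η f g lam k i j *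
      Real.exp (expoDiff C η (f' - f) (g' - g) (lam' - lam) (k, i, j)) := by
  simp only [zeta, Matrix.of_apply, expoDiff, ← Real.exp_add]
  congr 1
  simp only [Pi.sub_apply, PiLp.sub_apply]
  ring

/-- The ratio of the masses at two dual points is the normalising sum of a tilt of the plan; this
reduces statements about `F` to the exponential lemmas above. -/
theorem zetaMass_eq_mul [NeZero n] [NeZero N] :
    zetaMass C η f' g' lam' = zetaMass C η f g lam * ∑ m, planWeight C η f g lam m *
      Real.exp (expoDiff C η (f' - f) (g' - g) (lam' - lam) m) := by
  have h := (zetaMass_pos (C := C) (η := η) (f := f) (g := g) (lam := lam)).ne'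
  rw [zetaMass_eq (f := f'), Finset.mul_sum,
    ← sum_prod3 (fun k i j => zeta C η f' g' lam' k i j)]
  refine Finset.sum_congr rfl fun m _ => ?_
  rw [zeta_eq_mul_exp (f := f) (g := g) (lam := lam), planWeight, plan_apply]
  field_simp

theorem plan_eq_tilt [NeZero n] [NeZero N] (k : Fin N) (i j : Fin n) :
    plan C η f' g' lam' k i j = planWeight C η f g lam (k, i, j) *
      Real.exp (expoDiff C η (f' - f) (g' - g) (lam' - lam) (k, i, j)) /
      ∑ m, planWeight C η f g lam m *
        Real.exp (expoDiff C η (f' - f) (g' - g) (lam' - lam) m) := by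
  have h := (zetaMass_pos (C := C) (η := η) (f := f) (g := g) (lam := lam)).ne'
  rw [plan_apply, zetaMass_eq_mul (f := f) (g := g) (lam := lam), mul_inv,
    zeta_eq_mul_exp (f := f) (g := g) (lam := lam), planWeight, plan_apply, div_eq_mul_inv]
  ring

theorem sum_sum_sum_mul_row (P : Fin N → Matrix (Fin n) (Fin n) ℝ) (u : Fin n → ℝ) :
    ∑ k, ∑ i, ∑ j, P k i j * u i = ∑ i, rowSum (∑ k, P k) i * u i := by
  simp_rw [rowSum_sum, Finset.sum_mul]
  rw [Finset.sum_comm]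
  simp_rw [rowSum, Finset.sum_mul]

theorem sum_sum_sum_mul_col (P : Fin N → Matrix (Fin n) (Fin n) ℝ) (u : Fin n → ℝ) :
    ∑ k, ∑ i, ∑ j, P k i j * u j = ∑ j, colSum (∑ k, P k) j * u j := by
  simp_rw [colSum_sum, Finset.sum_mul]
  rw [Finset.sum_comm (f := fun (j : Fin n) (k : Fin N) => colSum (P k) j * u j)]
  simp_rw [colSum, Finset.sum_mul]
  exact Finset.sum_congr rfl fun k _ => Finset.sum_comm

theorem sum_planWeight_mul_expoDiff (u v : Fin n → ℝ) (w : EuclideanSpace ℝ (Fin N)) :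
    ∑ m, planWeight C η f g lam m * expoDiff C η u v w m =
      (∑ i, rowSum (∑ k, plan C η f g lam k) i * u i +
        ∑ j, colSum (∑ k, plan C η f g lam k) j * v j -
        ∑ k, w k * frob (plan C η f g lam k) (C k)) / η := by
  simp only [planWeight, expoDiff]
  rw [sum_prod3 (fun k i j => plan C η f g lam k i j * ((u i + v j - w k * C k i j) / η)),
    ← sum_sum_sum_mul_row, ← sum_sum_sum_mul_col]
  have e : ∀ k i j, plan C η f g lam k i j * ((u i + v j - w k * C k i j) / η) =
      (plan C η f g lam k i j * u i + plan C η f g lam k i j * v j -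
        w k * (plan C η f g lam k i j * C k i j)) / η := by
    intro k i j; ring
  simp_rw [e, ← Finset.sum_div, Finset.sum_sub_distrib, Finset.sum_add_distrib, ← Finset.mul_sum]
  rfl

/-- The directional derivative of `F` at `(f, g, λ)` along `(u, v, w)`. -/
noncomputable def dualDeriv (C : Fin N → Matrix (Fin n) (Fin n) ℝ) (a b : Fin n → ℝ) (η : ℝ)
    (f g : Fin n → ℝ) (lam : EuclideanSpace ℝ (Fin N)) (u v : Fin n → ℝ)
    (w : EuclideanSpace ℝ (Fin N)) : ℝ :=
  ∑ i, (a i - rowSum (∑ k, plan C η f g lam k) i) * u i +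
    ∑ j, (b j - colSum (∑ k, plan C η f g lam k) j) * v j +
    ∑ k, w k * frob (plan C η f g lam k) (C k)

theorem dualDeriv_eq (hη : η ≠ 0) (u v : Fin n → ℝ) (w : EuclideanSpace ℝ (Fin N)) :
    dualDeriv C a b η f g lam u v w = ∑ i, u i * a i + ∑ j, v j * b j -
      η * ∑ m, planWeight C η f g lam m * expoDiff C η u v w m := by
  rw [sum_planWeight_mul_expoDiff, mul_div_cancel₀ _ hη, dualDeriv]
  simp_rw [sub_mul, Finset.sum_sub_distrib, mul_comm (a _), mul_comm (b _)]
  ring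

/-- This differs from `dualDeriv_eq` only in having the log of a mean exponential where the
derivative has a mean, so Jensen and Hoeffding compare the two directly. -/
theorem dualF_sub [NeZero n] [NeZero N] :
    dualF C a b η f' g' lam' - dualF C a b η f g lam =
      ∑ i, (f' - f) i * a i + ∑ j, (g' - g) j * b j - η * Real.log (∑ m,
        planWeight C η f g lam m *
          Real.exp (expoDiff C η (f' - f) (g' - g) (lam' - lam) m)) := by
  have hpos := sum_mul_exp_pos (p := planWeight C η f g lam) (fun m => (planWeight_pos m).le)
    sum_planWeight (expoDiff C η (f' - f) (g' - g) (lam' - lam))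
  simp only [dualF]
  rw [zetaMass_eq_mul (f := f) (g := g) (lam := lam), Real.log_mul zetaMass_pos.ne' hpos.ne']
  simp only [Pi.sub_apply, sub_mul, Finset.sum_sub_distrib]
  ring

/-- Concavity of `F`. -/
theorem dualF_sub_le [NeZero n] [NeZero N] (hη : 0 < η) :
    dualF C a b η f' g' lam' - dualF C a b η f g lam ≤
      dualDeriv C a b η f g lam (f' - f) (g' - g) (lam' - lam) := by
  rw [dualF_sub, dualDeriv_eq hη.ne']
  have hp : ∀ m, 0 ≤ planWeight C η f g lam m := fun m => (planWeight_pos m).le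
  have h := exp_sum_mul_le_sum_mul_exp hp sum_planWeight
    (x := expoDiff C η (f' - f) (g' - g) (lam' - lam))
  rw [← Real.le_log_iff_exp_le (sum_mul_exp_pos hp sum_planWeight _)] at h
  have := mul_le_mul_of_nonneg_left h hη.le
  linarith

/-- Smoothness of `F`. -/
theorem le_dualF_sub [NeZero n] [NeZero N] (hη : 0 < η) {V : ℝ} (hV : 0 ≤ V)
    (h : ∀ m, |expoDiff C η (f' - f) (g' - g) (lam' - lam) m| ≤ V) :
    dualDeriv C a b η f g lam (f' - f) (g' - g) (lam' - lam) - η * V ^ 2 / 2 ≤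
      dualF C a b η f' g' lam' - dualF C a b η f g lam := by
  rw [dualF_sub, dualDeriv_eq hη.ne']
  have hp : ∀ m, 0 ≤ planWeight C η f g lam m := fun m => (planWeight_pos m).le
  have h := sum_mul_exp_le hp sum_planWeight hV h
  rw [← Real.log_le_iff_le_exp (sum_mul_exp_pos hp sum_planWeight _)] at h
  have := mul_le_mul_of_nonneg_left h hη.le
  linarith

theorem abs_apply_le_norm (w : EuclideanSpace ℝ (Fin N)) (k : Fin N) : |w k| ≤ ‖w‖ := by
  rw [← Real.norm_eq_abs]
  exact PiLp.norm_apply_le w k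

theorem abs_expoDiff_zero_le (hη : 0 < η) (hC : ∀ k i j, |C k i j| ≤ c)
    (w : EuclideanSpace ℝ (Fin N)) (m : Fin N × Fin n × Fin n) :
    |expoDiff C η 0 0 w m| ≤ ‖w‖ * c / η := by
  simp only [expoDiff, Pi.zero_apply, zero_add, zero_sub, abs_div, abs_neg, abs_mul,
    abs_of_pos hη]
  gcongr
  · exact abs_apply_le_norm _ _
  · exact hC _ _ _

/-- The gradient of `F` in `λ`. -/
noncomputable def gradLam (C : Fin N → Matrix (Fin n) (Fin n) ℝ) (η : ℝ) (f g : Fin n → ℝ)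
    (lam : EuclideanSpace ℝ (Fin N)) : EuclideanSpace ℝ (Fin N) :=
  WithLp.toLp 2 fun k => frob (plan C η f g lam k) (C k)

theorem inner_gradLam (w : EuclideanSpace ℝ (Fin N)) :
    inner ℝ (gradLam C η f g lam) w = ∑ k, w k * frob (plan C η f g lam k) (C k) := by
  simp [PiLp.inner_apply, gradLam]

theorem dualDeriv_zero_zero (w : EuclideanSpace ℝ (Fin N)) :
    dualDeriv C a b η f g lam 0 0 w = inner ℝ (gradLam C η f g lam) w := by
  simp [dualDeriv, inner_gradLam]

theorem dualF_lam_sub_le [NeZero n] [NeZero N] (hη : 0 < η) :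
    dualF C a b η f g lam' - dualF C a b η f g lam ≤
      inner ℝ (gradLam C η f g lam) (lam' - lam) := by
  have h := dualF_sub_le (C := C) (a := a) (b := b) (f := f) (g := g) (lam := lam) (f' := f)
    (g' := g) (lam' := lam') hη
  rwa [sub_self, sub_self, dualDeriv_zero_zero] at h

/-- A move by `w` in `λ` alone changes each exponent by at most `‖w‖ c / η`, so `F` is `c² /
η`-smooth in `λ`. -/
theorem le_dualF_lam_sub [NeZero n] [NeZero N] (hη : 0 < η) (hC : ∀ k i j, |C k i j| ≤ c) :
    inner ℝ (gradLam C η f g lam) (lam' - lam) - c ^ 2 / (2 * η) * ‖lam' - lam‖ ^ 2 ≤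
      dualF C a b η f g lam' - dualF C a b η f g lam := by
  have hc : 0 ≤ c := (abs_nonneg _).trans (hC 0 0 0)
  have h := le_dualF_sub (C := C) (a := a) (b := b) (f := f) (g := g) (lam := lam) (f' := f)
    (g' := g) (lam' := lam') hη (V := ‖lam' - lam‖ * c / η) (by positivity) (by
      rw [sub_self, sub_self]; exact abs_expoDiff_zero_le hη hC _)
  rw [sub_self, sub_self, dualDeriv_zero_zero] at h
  refine le_of_eq_of_le ?_ h
  field_simp

/-- Concavity and smoothness squeeze the linearisation error between `0` and a multiple of `-‖u‖²`;
no explicit differentiation is needed. -/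
theorem hasGradientAt_dualF [NeZero n] [NeZero N] (hη : 0 < η) :
    HasGradientAt (fun μ => dualF C a b η f g μ) (gradLam C η f g lam) lam := by
  obtain ⟨c, hC⟩ : ∃ c, ∀ k i j, |C k i j| ≤ c := by
    refine ⟨∑ k, ∑ i, ∑ j, |C k i j|, fun k i j => ?_⟩
    rw [← sum_prod3 (fun k i j => |C k i j|)]
    exact Finset.single_le_sum (f := fun m : Fin N × Fin n × Fin n => |C m.1 m.2.1 m.2.2|)
      (fun _ _ => abs_nonneg _) (Finset.mem_univ (k, i, j))
  rw [hasGradientAt_iff_hasFDerivAt, hasFDerivAt_iff_isLittleO_nhds_zero]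
  refine Asymptotics.IsBigO.trans_isLittleO (g := fun u : EuclideanSpace ℝ (Fin N) => ‖u‖ ^ 2)
    ?_ (Asymptotics.isLittleO_norm_pow_id one_lt_two)
  refine Asymptotics.IsBigO.of_bound (c ^ 2 / (2 * η)) (Filter.Eventually.of_forall fun u => ?_)
  have h1 := dualF_lam_sub_le (C := C) (a := a) (b := b) (f := f) (g := g) (lam := lam)
    (lam' := lam + u) hη
  have h2 := le_dualF_lam_sub (C := C) (a := a) (b := b) (f := f) (g := g) (lam := lam)
    (lam' := lam + u) hη hC
  rw [add_sub_cancel_left] at h1 h2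
  rw [InnerProductSpace.toDual_apply_apply, Real.norm_eq_abs, Real.norm_eq_abs, abs_of_nonneg
    (sq_nonneg ‖u‖), abs_le]
  have : 0 ≤ c ^ 2 / (2 * η) * ‖u‖ ^ 2 := by positivity
  constructor <;> linarith

theorem gradient_dualF [NeZero n] [NeZero N] (hη : 0 < η) :
    gradient (fun μ => dualF C a b η f g μ) lam = gradLam C η f g lam :=
  (hasGradientAt_dualF hη).gradient

/-- The gradient in `λ` is `c² / η`-Lipschitz in `λ`. -/
theorem abs_inner_gradLam_sub_le [NeZero n] [NeZero N] (hη : 0 < η)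
    (hC : ∀ k i j, |C k i j| ≤ c) (w : EuclideanSpace ℝ (Fin N)) :
    |inner ℝ (gradLam C η f g lam' - gradLam C η f g lam) w| ≤
      c ^ 2 / η * ‖lam' - lam‖ * ‖w‖ := by
  have hc : 0 ≤ c := (abs_nonneg _).trans (hC 0 0 0)
  have h := abs_tilted_mean_sub_le (p := planWeight C η f g lam)
    (x := expoDiff C η 0 0 (lam' - lam)) (w := expoDiff C η 0 0 w)
    (fun m => (planWeight_pos m).le) sum_planWeight (V := ‖lam' - lam‖ * c / η) (by positivity)
    (abs_expoDiff_zero_le hη hC _) (abs_expoDiff_zero_le hη hC _)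
  -- The plan at `lam'` is the tilt of the plan at `lam`, so both gradients are means of the same
  -- function under a weight and its tilt.
  have e : (∑ m, planWeight C η f g lam m * Real.exp (expoDiff C η 0 0 (lam' - lam) m) *
      expoDiff C η 0 0 w m) / (∑ m, planWeight C η f g lam m *
        Real.exp (expoDiff C η 0 0 (lam' - lam) m)) =
      ∑ m, planWeight C η f g lam' m * expoDiff C η 0 0 w m := by
    rw [Finset.sum_div]
    refine Finset.sum_congr rfl fun m _ => ?_
    have := plan_eq_tilt (C := C) (η := η) (f := f) (g := g) (lam := lam) (f' := f) (g' := g)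
      (lam' := lam') m.1 m.2.1 m.2.2
    rw [sub_self, sub_self] at this
    rw [show planWeight C η f g lam' m = _ from this, div_mul_eq_mul_div]
  rw [e, sum_planWeight_mul_expoDiff, sum_planWeight_mul_expoDiff] at h
  simp only [Pi.zero_apply, mul_zero, Finset.sum_const_zero, zero_add, zero_sub,
    ← inner_gradLam] at h
  rw [inner_sub_left]
  rw [← sub_div, abs_div, abs_of_pos hη, div_le_iff₀ hη, neg_sub_neg, abs_sub_comm] at h
  refine h.trans (le_of_eq ?_)
  field_simp

theorem norm_gradLam_le [NeZero n] [NeZero N] (hC : ∀ k i j, |C k i j| ≤ c) :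
    ‖gradLam C η f g lam‖ ≤ c := by
  have hc : 0 ≤ c := (abs_nonneg _).trans (hC 0 0 0)
  have h1 : ∀ w : EuclideanSpace ℝ (Fin N), |inner ℝ (gradLam C η f g lam) w| ≤ c * ‖w‖ := by
    intro w
    rw [inner_gradLam]
    have : ∑ k, w k * frob (plan C η f g lam k) (C k) =
        ∑ m : Fin N × Fin n × Fin n, planWeight C η f g lam m * (w m.1 * C m.1 m.2.1 m.2.2) := by
      simp only [planWeight]
      rw [sum_prod3 (fun k i j => plan C η f g lam k i j * (w k * C k i j))]
      simp_rw [frob, Finset.mul_sum]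
      refine Finset.sum_congr rfl fun k _ => Finset.sum_congr rfl fun i _ =>
        Finset.sum_congr rfl fun j _ => by ring
    rw [this]
    calc _ ≤ ∑ m : Fin N × Fin n × Fin n,
          |planWeight C η f g lam m * (w m.1 * C m.1 m.2.1 m.2.2)| :=
        Finset.abs_sum_le_sum_abs _ _
      _ ≤ ∑ m, planWeight C η f g lam m * (c * ‖w‖) := Finset.sum_le_sum fun m _ => by
        rw [abs_mul, abs_of_pos (planWeight_pos m), abs_mul, mul_comm c]
        exact mul_le_mul_of_nonneg_left (mul_le_mul (abs_apply_le_norm _ _) (hC _ _ _)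
          (abs_nonneg _) (norm_nonneg _)) (planWeight_pos m).le
      _ = c * ‖w‖ := by rw [← Finset.sum_mul, sum_planWeight, one_mul]
  have h2 := h1 (gradLam C η f g lam)
  rw [real_inner_self_eq_norm_sq, abs_of_nonneg (sq_nonneg _)] at h2
  by_contra h
  push Not at h
  have : 0 < ‖gradLam C η f g lam‖ := hc.trans_lt h
  nlinarith

end Dual

end EOT

namespace EOT

/-! ### Progress and first-order gaps of a single iteration -/

section Step

variable {n N : ℕ} {C : Fin N → Matrix (Fin n) (Fin n) ℝ} {a b : Fin n → ℝ} {η c : ℝ}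
  {f g f' g' : Fin n → ℝ} {lam lam' y μ : EuclideanSpace ℝ (Fin N)}

theorem rowSum_zeta_pos [NeZero n] [NeZero N] (i : Fin n) :
    0 < rowSum (∑ k, zeta C η f g lam k) i := by
  rw [rowSum_sum]
  exact Finset.sum_pos (fun k _ => Finset.sum_pos (fun j _ => zeta_pos k i j)
    Finset.univ_nonempty) Finset.univ_nonempty

theorem colSum_zeta_pos [NeZero n] [NeZero N] (j : Fin n) :
    0 < colSum (∑ k, zeta C η f g lam k) j := by
  rw [colSum_sum]
  exact Finset.sum_pos (fun k _ => Finset.sum_pos (fun i _ => zeta_pos k i j)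
    Finset.univ_nonempty) Finset.univ_nonempty

theorem zeta_fUpdate [NeZero n] [NeZero N] (hη : 0 < η) (ha : ∀ i, 0 < a i) (k : Fin N)
    (i j : Fin n) : zeta C η (fUpdate C a η f g lam) g lam k i j =
      zeta C η f g lam k i j * (a i / rowSum (∑ k, zeta C η f g lam k) i) := by
  have hpos := div_pos (ha i) (rowSum_zeta_pos (C := C) (η := η) (f := f) (g := g) (lam := lam) i)
  rw [zeta_eq_mul_exp (f := f) (g := g) (lam := lam), ← Real.exp_log hpos]
  congr 2
  simp only [expoDiff, fUpdate, sub_self, Pi.sub_apply, PiLp.zero_apply, zero_mul,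
    add_sub_cancel_left, sub_zero, add_zero]
  rw [mul_div_cancel_left₀ _ hη.ne']

theorem zeta_gUpdate [NeZero n] [NeZero N] (hη : 0 < η) (hb : ∀ i, 0 < b i) (k : Fin N)
    (i j : Fin n) : zeta C η f (gUpdate C b η f g lam) lam k i j =
      zeta C η f g lam k i j * (b j / colSum (∑ k, zeta C η f g lam k) j) := by
  have hpos := div_pos (hb j) (colSum_zeta_pos (C := C) (η := η) (f := f) (g := g) (lam := lam) j)
  rw [zeta_eq_mul_exp (f := f) (g := g) (lam := lam), ← Real.exp_log hpos]
  congr 2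
  simp only [expoDiff, gUpdate, sub_self, Pi.sub_apply, PiLp.zero_apply, zero_mul,
    add_sub_cancel_left, sub_zero, zero_add]
  rw [mul_div_cancel_left₀ _ hη.ne']

theorem rowSum_zeta_fUpdate [NeZero n] [NeZero N] (hη : 0 < η) (ha : ∀ i, 0 < a i) :
    rowSum (∑ k, zeta C η (fUpdate C a η f g lam) g lam k) = a := by
  ext i
  rw [rowSum_sum]
  simp only [rowSum, zeta_fUpdate hη ha]
  simp_rw [← Finset.sum_mul]
  have h := (rowSum_zeta_pos (C := C) (η := η) (f := f) (g := g) (lam := lam) i).ne'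
  rw [show ∑ k, ∑ j, zeta C η f g lam k i j = rowSum (∑ k, zeta C η f g lam k) i from
    (rowSum_sum _ i).symm]
  exact mul_div_cancel₀ _ h

theorem colSum_zeta_gUpdate [NeZero n] [NeZero N] (hη : 0 < η) (hb : ∀ i, 0 < b i) :
    colSum (∑ k, zeta C η f (gUpdate C b η f g lam) lam k) = b := by
  ext j
  rw [colSum_sum]
  simp only [colSum, zeta_gUpdate hη hb]
  simp_rw [← Finset.sum_mul]
  have h := (colSum_zeta_pos (C := C) (η := η) (f := f) (g := g) (lam := lam) j).ne'
  rw [show ∑ k, ∑ i, zeta C η f g lam k i j = colSum (∑ k, zeta C η f g lam k) j from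
    (colSum_sum _ j).symm]
  exact mul_div_cancel₀ _ h

theorem zetaMass_fUpdate [NeZero n] [NeZero N] (hη : 0 < η) (ha : ∀ i, 0 < a i)
    (ha1 : ∑ i, a i = 1) : zetaMass C η (fUpdate C a η f g lam) g lam = 1 := by
  rw [zetaMass_eq_sum_rowSum, rowSum_zeta_fUpdate hη ha, ha1]

theorem zetaMass_gUpdate [NeZero n] [NeZero N] (hη : 0 < η) (hb : ∀ i, 0 < b i)
    (hb1 : ∑ i, b i = 1) : zetaMass C η f (gUpdate C b η f g lam) lam = 1 := by
  rw [zetaMass_eq_sum_colSum, colSum_zeta_gUpdate hη hb, hb1]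

theorem plan_eq_zeta (h : zetaMass C η f g lam = 1) :
    plan C η f g lam = zeta C η f g lam := by
  ext k i j
  rw [plan_apply, h, inv_one, one_mul]

/-- The update makes the mass `1` and the row sums `a`, so the `f`-derivative of `F` vanishes there;
by concavity it is an exact maximiser in `f`. -/
theorem le_dualF_fUpdate [NeZero n] [NeZero N] (hη : 0 < η) (ha : ∀ i, 0 < a i)
    (ha1 : ∑ i, a i = 1) (f₀ : Fin n → ℝ) :
    dualF C a b η f₀ g lam ≤ dualF C a b η (fUpdate C a η f g lam) g lam := by
  have h := dualF_sub_le (C := C) (a := a) (b := b) (f := fUpdate C a η f g lam) (g := g)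
    (lam := lam) (f' := f₀) (g' := g) (lam' := lam) hη
  rw [dualDeriv, plan_eq_zeta (zetaMass_fUpdate hη ha ha1), rowSum_zeta_fUpdate hη ha] at h
  simp at h
  exact h

theorem le_dualF_gUpdate [NeZero n] [NeZero N] (hη : 0 < η) (hb : ∀ i, 0 < b i)
    (hb1 : ∑ i, b i = 1) (g₀ : Fin n → ℝ) :
    dualF C a b η f g₀ lam ≤ dualF C a b η f (gUpdate C b η f g lam) lam := by
  have h := dualF_sub_le (C := C) (a := a) (b := b) (f := f) (g := gUpdate C b η f g lam)
    (lam := lam) (f' := f) (g' := g₀) (lam' := lam) hη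
  rw [dualDeriv, plan_eq_zeta (zetaMass_gUpdate hη hb hb1), colSum_zeta_gUpdate hη hb] at h
  simp at h
  exact h

theorem l1_nonneg (v : Fin n → ℝ) : 0 ≤ l1 v := Finset.sum_nonneg fun _ _ => abs_nonneg _

/-- Progress of the update of `g`. -/
theorem dualF_gUpdate_sub_ge [NeZero n] [NeZero N] (hη : 0 < η) (hb : ∀ i, 0 < b i)
    (hb1 : ∑ i, b i = 1) :
    η / 2 * l1 (colSum (∑ k, plan C η f g lam k) - b) ^ 2 ≤
      dualF C a b η f (gUpdate C b η f g lam) lam - dualF C a b η f g lam := by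
  set v := colSum (∑ k, plan C η f g lam k) - b with hv
  set A := l1 v with hA
  have hA0 : 0 ≤ A := l1_nonneg v
  -- The exact update is at least as good as this signed trial step of exponent size `A`: its
  -- first-order gain is `η A²` and its smoothness loss is `η A² / 2`.
  set x : Fin n → ℝ := fun j => η * A * (if 0 ≤ v j then -1 else 1) with hx
  have h1 := le_dualF_sub (C := C) (a := a) (b := b) (f := f) (g := g) (lam := lam) (f' := f)
    (g' := g + x) (lam' := lam) hη hA0 (by
      intro m
      have e : expoDiff C η (f - f) (g + x - g) (lam - lam) m =
          A * (if 0 ≤ v m.2.2 then -1 else 1) := by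
        simp [expoDiff, hx]
        split_ifs <;> field_simp
      rw [e, abs_mul, abs_of_nonneg hA0]
      split_ifs <;> simp)
  have h2 := le_dualF_gUpdate (C := C) (a := a) (f := f) (g := g) (lam := lam) hη hb hb1 (g + x)
  have h3 : dualDeriv C a b η f g lam (f - f) (g + x - g) (lam - lam) = η * A ^ 2 := by
    have e : ∀ j, (b j - colSum (∑ k, plan C η f g lam k) j) * x j = η * A * |v j| := by
      intro j
      have : b j - colSum (∑ k, plan C η f g lam k) j = - v j := by simp [hv]
      rw [this, hx]
      by_cases hj : 0 ≤ v j
      · simp only [hj, if_true, abs_of_nonneg hj]; ring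
      · simp only [hj, if_false, abs_of_neg (not_le.1 hj)]; ring
    simp only [dualDeriv, sub_self, add_sub_cancel_left, e, ← Finset.mul_sum]
    simp only [Pi.zero_apply, mul_zero, Finset.sum_const_zero, PiLp.zero_apply, zero_mul, hA, l1]
    ring
  rw [h3] at h1
  linarith

theorem simplex_le_one (h : lam ∈ simplex N) (k : Fin N) : lam k ≤ 1 := by
  rw [← h.2]
  exact Finset.single_le_sum (fun k _ => h.1 k) (Finset.mem_univ k)

theorem convex_simplex : Convex ℝ (simplex N) := by
  intro x hx y hy s t hs ht hst
  exact convex_stdSimplex ℝ (Fin N) hx hy hs ht hst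

/-- The diameter of the simplex is at most `√2`; `3 / 2` is a convenient rational bound. -/
theorem norm_sub_le_of_mem_simplex (h : lam ∈ simplex N) (h' : lam' ∈ simplex N) :
    ‖lam - lam'‖ ≤ 3 / 2 := by
  have h1 : ‖lam - lam'‖ ^ 2 ≤ 2 := by
    rw [EuclideanSpace.norm_sq_eq]
    calc ∑ k, ‖(lam - lam') k‖ ^ 2 ≤ ∑ k, (lam k + lam' k) := Finset.sum_le_sum fun k _ => by
          have e1 : 0 ≤ lam k := h.1 k
          have e2 : 0 ≤ lam' k := h'.1 k
          have e3 := simplex_le_one h k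
          have e4 := simplex_le_one h' k
          rw [Real.norm_eq_abs, sq_abs, PiLp.sub_apply]
          nlinarith [mul_nonneg e1 e2]
      _ = 2 := by
          rw [Finset.sum_add_distrib]
          have e1 : ∑ k, lam k = 1 := h.2
          have e2 : ∑ k, lam' k = 1 := h'.2
          rw [e1, e2]; norm_num
  nlinarith [norm_nonneg (lam - lam')]

theorem inner_projSimplex_le [NeZero N] (x : EuclideanSpace ℝ (Fin N)) (h : μ ∈ simplex N) :
    inner ℝ (x - projSimplex x) (μ - projSimplex x) ≤ 0 := by
  obtain ⟨hp, hmin⟩ := projSimplex_spec (NeZero.pos N) x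
  refine (norm_eq_iInf_iff_real_inner_le_zero convex_simplex hp).1 ?_ μ h
  have : Nonempty (simplex N) := ⟨⟨_, hp⟩⟩
  refine le_antisymm (le_ciInf fun q => hmin q q.2) ?_
  exact ciInf_le ⟨0, by rintro _ ⟨q, rfl⟩; exact norm_nonneg _⟩ (⟨_, hp⟩ : simplex N)

theorem norm_projSimplex_sub_le [NeZero N] (x : EuclideanSpace ℝ (Fin N)) (h : μ ∈ simplex N) :
    ‖projSimplex x - μ‖ ≤ ‖x - μ‖ := by
  have h1 := inner_projSimplex_le x h
  set p := projSimplex x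
  have h2 : inner ℝ (x - p) (μ - p) + inner ℝ (x - μ) (p - μ) = ‖p - μ‖ ^ 2 := by
    rw [← real_inner_self_eq_norm_sq, ← neg_sub p μ, inner_neg_right, neg_add_eq_sub,
      ← inner_sub_left]
    congr 1
    abel
  have h3 := real_inner_le_norm (x - μ) (p - μ)
  by_contra h4
  push Not at h4
  nlinarith [norm_nonneg (x - μ), norm_nonneg (p - μ)]

/-- Progress of the proximal gradient step in `λ`. -/
theorem dualF_prox_sub_ge [NeZero n] [NeZero N] (hη : 0 < η) (hc : 0 < c)
    (hC : ∀ k i j, |C k i j| ≤ c) (hlam : lam ∈ simplex N)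
    (hlam' : lam' = projSimplex (y + (η / (2 * c ^ 2)) • gradLam C η f g y)) :
    c ^ 2 / η * (‖lam' - lam‖ ^ 2 - ‖lam - y‖ ^ 2) + c ^ 2 / (2 * η) * ‖lam' - y‖ ^ 2 ≤
      dualF C a b η f g lam' - dualF C a b η f g lam := by
  -- The increment is split at `y`: concavity bounds the value at `lam`, smoothness the value at
  -- `lam'`, and the projection inequality compares the two linear terms. The step size is half the
  -- inverse smoothness constant, so half of the term in `‖lam' - y‖²` survives.
  have h1 := dualF_lam_sub_le (C := C) (a := a) (b := b) (f := f) (g := g) (lam := y)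
    (lam' := lam) hη
  have h2 := le_dualF_lam_sub (C := C) (a := a) (b := b) (f := f) (g := g) (lam := y)
    (lam' := lam') hη hC
  have h3 := inner_projSimplex_le (y + (η / (2 * c ^ 2)) • gradLam C η f g y) hlam
  rw [← hlam'] at h3
  have h4 : inner ℝ (y + (η / (2 * c ^ 2)) • gradLam C η f g y - lam') (lam - lam') =
      η / (2 * c ^ 2) * (inner ℝ (gradLam C η f g y) (lam - y) -
        inner ℝ (gradLam C η f g y) (lam' - y)) -
      (‖lam - y‖ ^ 2 - ‖lam' - y‖ ^ 2 - ‖lam' - lam‖ ^ 2) / 2 := by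
    rw [← inner_sub_right, sub_sub_sub_cancel_right,
      show y + (η / (2 * c ^ 2)) • gradLam C η f g y - lam' =
        (η / (2 * c ^ 2)) • gradLam C η f g y - (lam' - y) by abel, inner_sub_left,
      real_inner_smul_left]
    have : ‖lam - y‖ ^ 2 = ‖lam - lam'‖ ^ 2 + 2 * inner ℝ (lam - lam') (lam' - y) +
        ‖lam' - y‖ ^ 2 := by
      rw [← norm_add_sq_real]; congr 2; abel
    rw [this, norm_sub_rev lam' lam, real_inner_comm (lam' - y) (lam - lam')]
    ring
  rw [h4] at h3
  have h5 : inner ℝ (gradLam C η f g y) (lam - y) - inner ℝ (gradLam C η f g y) (lam' - y) ≤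
      c ^ 2 / η * (‖lam - y‖ ^ 2 - ‖lam' - y‖ ^ 2 - ‖lam' - lam‖ ^ 2) := by
    have := mul_le_mul_of_nonneg_left h3 (show 0 ≤ 2 * c ^ 2 / η by positivity)
    rw [mul_zero, mul_sub, ← mul_assoc, show 2 * c ^ 2 / η * (η / (2 * c ^ 2)) = 1 by
      field_simp, one_mul] at this
    have e : 2 * c ^ 2 / η * ((‖lam - y‖ ^ 2 - ‖lam' - y‖ ^ 2 - ‖lam' - lam‖ ^ 2) / 2) =
      c ^ 2 / η * (‖lam - y‖ ^ 2 - ‖lam' - y‖ ^ 2 - ‖lam' - lam‖ ^ 2) := by ring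
    linarith
  have e : c ^ 2 / (2 * η) = c ^ 2 / η / 2 := by field_simp
  rw [e] at h2 ⊢
  nlinarith

/-- The update of `g` multiplies column `j` by `b j / S j`, hence moves mass `|S j - b j|` in that
column; each unit moved changes the pairing by at most `c`. -/
theorem inner_gradLam_sub_gUpdate_le [NeZero n] [NeZero N] (hη : 0 < η) (hb : ∀ i, 0 < b i)
    (hb1 : ∑ i, b i = 1) (hC : ∀ k i j, |C k i j| ≤ c) (hmass : zetaMass C η f g lam = 1)
    {w : EuclideanSpace ℝ (Fin N)} (hw : ∀ k, |w k| ≤ 1) :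
    inner ℝ (gradLam C η f g lam - gradLam C η f (gUpdate C b η f g lam) lam) w ≤
      c * l1 (colSum (∑ k, plan C η f g lam k) - b) := by
  have hc : 0 ≤ c := (abs_nonneg _).trans (hC 0 0 0)
  set S := colSum (∑ k, zeta C η f g lam k) with hS
  have hSpos : ∀ j, 0 < S j := colSum_zeta_pos
  rw [inner_sub_left, inner_gradLam, inner_gradLam, plan_eq_zeta hmass,
    plan_eq_zeta (zetaMass_gUpdate hη hb hb1), ← Finset.sum_sub_distrib]
  have e1 : ∀ k, w k * frob (zeta C η f g lam k) (C k) -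
      w k * frob (zeta C η f (gUpdate C b η f g lam) lam k) (C k) =
      ∑ i, ∑ j, zeta C η f g lam k i j * ((1 - b j / S j) * (w k * C k i j)) := by
    intro k
    simp only [frob, Finset.mul_sum, ← Finset.sum_sub_distrib, zeta_gUpdate hη hb]
    refine Finset.sum_congr rfl fun i _ => Finset.sum_congr rfl fun j _ => by ring
  calc _ ≤ ∑ k, ∑ i, ∑ j, zeta C η f g lam k i j * (|1 - b j / S j| * c) := by
        refine Finset.sum_le_sum fun k _ => ?_
        rw [e1]
        refine Finset.sum_le_sum fun i _ => Finset.sum_le_sum fun j _ =>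
          mul_le_mul_of_nonneg_left ?_ (zeta_pos k i j).le
        refine (le_abs_self _).trans ?_
        rw [abs_mul, abs_mul]
        refine mul_le_mul_of_nonneg_left ?_ (abs_nonneg _)
        calc |w k| * |C k i j| ≤ 1 * c := mul_le_mul (hw k) (hC k i j) (abs_nonneg _) zero_le_one
          _ = c := one_mul c
    _ = ∑ j, S j * (|1 - b j / S j| * c) :=
        sum_sum_sum_mul_col (zeta C η f g lam) (fun j => |1 - b j / S j| * c)
    _ = c * l1 (S - b) := by
        rw [l1, Finset.mul_sum]
        refine Finset.sum_congr rfl fun j _ => ?_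
        have : |(S - b) j| = S j * |1 - b j / S j| := by
          rw [← abs_of_pos (hSpos j), ← abs_mul, abs_of_pos (hSpos j), mul_sub, mul_one,
            mul_div_cancel₀ _ (hSpos j).ne', Pi.sub_apply]
        rw [this]; ring

/-- Bound on the gap in `λ` by the quantities that an iteration controls. -/
theorem inner_gradLam_le [NeZero n] [NeZero N] (hη : 0 < η) (hc : 0 < c) (hηc : η ≤ c)
    (hb : ∀ i, 0 < b i) (hb1 : ∑ i, b i = 1) (hC : ∀ k i j, |C k i j| ≤ c)
    (hmass : zetaMass C η f g lam = 1) (hlam : lam ∈ simplex N)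
    (hg' : g' = gUpdate C b η f g lam)
    (hlam' : lam' = projSimplex (y + (η / (2 * c ^ 2)) • gradLam C η f g' y))
    (hμ : μ ∈ simplex N) :
    inner ℝ (gradLam C η f g lam) (μ - lam) ≤
      c * l1 (colSum (∑ k, plan C η f g lam k) - b) +
        c ^ 2 / η * (5 / 2 * ‖lam - y‖ + 4 * ‖lam' - y‖) := by
  have hlam'mem : lam' ∈ simplex N := by
    rw [hlam']; exact (projSimplex_spec (NeZero.pos N) _).1
  have h1 := inner_gradLam_sub_gUpdate_le (w := μ - lam) hη hb hb1 hC hmass (by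
    intro k
    rw [PiLp.sub_apply, abs_le]
    have e1 : 0 ≤ lam k := hlam.1 k
    have e2 : 0 ≤ μ k := hμ.1 k
    have e3 := simplex_le_one hlam k
    have e4 := simplex_le_one hμ k
    constructor <;> linarith)
  rw [← hg'] at h1
  have hκ : 0 < c ^ 2 / η := by positivity
  have h2 : inner ℝ (gradLam C η f g' lam - gradLam C η f g' y) (μ - lam) ≤
      c ^ 2 / η * ‖lam - y‖ * (3 / 2) :=
    (le_abs_self _).trans ((abs_inner_gradLam_sub_le hη hC _).trans
      (mul_le_mul_of_nonneg_left (norm_sub_le_of_mem_simplex hμ hlam) (by positivity)))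
  have h3 : inner ℝ (gradLam C η f g' y) (μ - lam') ≤ c ^ 2 / η * (3 * ‖lam' - y‖) := by
    have h := inner_projSimplex_le (y + (η / (2 * c ^ 2)) • gradLam C η f g' y) hμ
    rw [← hlam', show y + (η / (2 * c ^ 2)) • gradLam C η f g' y - lam' =
        (η / (2 * c ^ 2)) • gradLam C η f g' y - (lam' - y) by abel, inner_sub_left,
      real_inner_smul_left] at h
    have h' := real_inner_le_norm (lam' - y) (μ - lam')
    have h'' := mul_le_mul_of_nonneg_left (norm_sub_le_of_mem_simplex hμ hlam'mem)
      (norm_nonneg (lam' - y))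
    have h4 := mul_le_mul_of_nonneg_left (h.trans_eq (sub_self (0 : ℝ)).symm)
      (show 0 ≤ 2 * c ^ 2 / η by positivity)
    rw [mul_sub, ← mul_assoc, show 2 * c ^ 2 / η * (η / (2 * c ^ 2)) = 1 by field_simp,
      one_mul, sub_self, mul_zero] at h4
    have h5 : 2 * c ^ 2 / η * inner ℝ (lam' - y) (μ - lam') ≤
        2 * c ^ 2 / η * (‖lam' - y‖ * (3 / 2)) :=
      mul_le_mul_of_nonneg_left (h'.trans h'') (by positivity)
    have e : 2 * c ^ 2 / η * (‖lam' - y‖ * (3 / 2)) = c ^ 2 / η * (3 * ‖lam' - y‖) := by ring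
    linarith
  have h4 : inner ℝ (gradLam C η f g' y) (lam' - lam) ≤
      c ^ 2 / η * (‖lam' - y‖ + ‖lam - y‖) := by
    have e1 := real_inner_le_norm (gradLam C η f g' y) (lam' - lam)
    have e2 := norm_gradLam_le (η := η) (f := f) (g := g') (lam := y) hC
    have e3 : ‖lam' - lam‖ ≤ ‖lam' - y‖ + ‖lam - y‖ := by
      rw [norm_sub_rev lam y]
      exact norm_sub_le_norm_sub_add_norm_sub _ _ _
    -- This is where `η ≤ c_∞`, built into the choice of `η`, is needed.
    have e4 : c ≤ c ^ 2 / η := by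
      rw [le_div_iff₀ hη, sq]
      exact mul_le_mul_of_nonneg_left hηc hc.le
    calc _ ≤ _ := e1
      _ ≤ c * (‖lam' - y‖ + ‖lam - y‖) := mul_le_mul e2 e3 (norm_nonneg _) hc.le
      _ ≤ _ := mul_le_mul_of_nonneg_right e4 (by positivity)
  -- The base point of the gradient moves from `g` to `g'`, then from `lam` to `y`, where the
  -- projection inequality applies; the remainder is the pairing with `lam' - lam`. The coefficients
  -- add up as `5 / 2 = 3 / 2 + 1` and `4 = 3 + 1`.
  have h5 : inner ℝ (gradLam C η f g lam) (μ - lam) =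
      inner ℝ (gradLam C η f g lam - gradLam C η f g' lam) (μ - lam) +
      inner ℝ (gradLam C η f g' lam - gradLam C η f g' y) (μ - lam) +
      inner ℝ (gradLam C η f g' y) (μ - lam') + inner ℝ (gradLam C η f g' y) (lam' - lam) := by
    rw [add_assoc _ (inner ℝ (gradLam C η f g' y) (μ - lam')), ← inner_add_right,
      sub_add_sub_cancel, ← inner_add_left, ← inner_add_left]
    congr 1
    abel
  rw [h5]
  linarith

/-- After the update the column sums are `b`. Exchanging columns `j` and `l` changes each cost term
by at most `2 c`, so `exp ((G j - G l - 2 c) / η) * b l ≤ b j ≤ 1`; then take logarithms. -/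
theorem gUpdate_sub_le [NeZero n] [NeZero N] (hη : 0 < η) (hb : ∀ i, 0 < b i)
    (hb1 : ∑ i, b i = 1) (hC : ∀ k i j, |C k i j| ≤ c) (hlam : lam ∈ simplex N) (j l : Fin n) :
    gUpdate C b η f g lam j - gUpdate C b η f g lam l ≤ 2 * c - η * iota b := by
  set G := gUpdate C b η f g lam with hG
  have hcol := fun j => congrFun (colSum_zeta_gUpdate (C := C) (f := f) (g := g) (lam := lam)
    hη hb) j
  rw [← hG] at hcol
  have hbj : b j ≤ 1 := by
    rw [← hb1]; exact Finset.single_le_sum (fun i _ => (hb i).le) (Finset.mem_univ j)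
  have hι : iota b ≤ Real.log (b l) := ciInf_le (Set.finite_range _).bddBelow l
  have hc : 0 ≤ c := (abs_nonneg _).trans (hC 0 0 0)
  have key : Real.exp ((G j - G l - 2 * c) / η) * b l ≤ b j := by
    rw [← hcol j, ← hcol l, colSum_sum, colSum_sum, Finset.mul_sum]
    refine Finset.sum_le_sum fun k _ => ?_
    rw [colSum, colSum, Finset.mul_sum]
    refine Finset.sum_le_sum fun i _ => ?_
    simp only [zeta, Matrix.of_apply, ← Real.exp_add, ← add_div]
    refine Real.exp_le_exp.2 (div_le_div_of_nonneg_right ?_ hη.le)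
    have e : ∀ j, |lam k * C k i j| ≤ c := by
      intro j
      rw [abs_mul, abs_of_nonneg (hlam.1 k)]
      calc _ ≤ 1 * c := mul_le_mul (simplex_le_one hlam k) (hC k i j) (abs_nonneg _) zero_le_one
        _ = c := one_mul c
    have e1 := abs_le.1 (e j)
    have e2 := abs_le.1 (e l)
    linarith
  have h2 := Real.log_le_log (mul_pos (Real.exp_pos _) (hb l)) (key.trans hbj)
  rw [Real.log_mul (Real.exp_pos _).ne' (hb l).ne', Real.log_exp, Real.log_one] at h2
  have h3 : (G j - G l - 2 * c) / η ≤ - iota b := by linarith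
  rw [div_le_iff₀ hη] at h3
  linarith

/-- Since `v` has sum zero, `h` may be shifted to its midrange, which halves its oscillation. -/
theorem sum_mul_le_of_sub_le [NeZero n] {v h : Fin n → ℝ} {R : ℝ} (hv : ∑ j, v j = 0)
    (hh : ∀ j l, h j - h l ≤ 2 * R) : ∑ j, v j * h j ≤ R * l1 v := by
  obtain ⟨p, hp⟩ := Finite.exists_max h
  obtain ⟨q, hq⟩ := Finite.exists_min h
  set m := (h p + h q) / 2 with hm
  have e : ∑ j, v j * h j = ∑ j, v j * (h j - m) := by
    simp_rw [mul_sub, Finset.sum_sub_distrib, ← Finset.sum_mul, hv]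
    ring
  rw [e, l1, Finset.mul_sum]
  refine Finset.sum_le_sum fun j _ => (le_abs_self _).trans ?_
  rw [abs_mul, mul_comm]
  refine mul_le_mul_of_nonneg_right ?_ (abs_nonneg _)
  rw [abs_le]
  have := hh p q
  have := hp j
  have := hq j
  constructor <;> linarith

end Step

end EOT

namespace EOT

/-! ### Hamiltonian decrease and dual gap in terms of the three errors -/

section Progress

variable {n N : ℕ} {C : Fin N → Matrix (Fin n) (Fin n) ℝ} {a b : Fin n → ℝ} {ε θ : ℝ}

theorem abs_le_cInf (k : Fin N) (i j : Fin n) : |C k i j| ≤ cInf C :=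
  (le_ciSup (f := fun j => |C k i j|) (Set.finite_range _).bddAbove j).trans
    ((le_ciSup (f := fun i => ⨆ j, |C k i j|) (Set.finite_range _).bddAbove i).trans
      (le_ciSup (f := fun k => ⨆ i, ⨆ j, |C k i j|) (Set.finite_range _).bddAbove k))

/-- The standing assumptions on the data of the problem. -/
structure IsData (C : Fin N → Matrix (Fin n) (Fin n) ℝ) (a b : Fin n → ℝ) (ε θ : ℝ) : Prop where
  a_mem : a ∈ stdSimplex ℝ (Fin n)
  a_pos : ∀ i, 0 < a i
  b_mem : b ∈ stdSimplex ℝ (Fin n)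
  b_pos : ∀ j, 0 < b j
  cInf_pos : 0 < cInf C
  eps_pos : 0 < ε
  theta_pos : 0 < θ
  theta_lt : θ < 1

/-- A supremum over an empty index type is `0`, so `0 < cInf C` also encodes `n, N ≥ 1`. -/
theorem neZero_left_of_cInf_pos (h : 0 < cInf C) : NeZero n := by
  refine ⟨?_⟩
  rintro rfl
  have : cInf C = 0 := by simp [cInf]
  linarith

theorem neZero_right_of_cInf_pos (h : 0 < cInf C) : NeZero N := by
  refine ⟨?_⟩
  rintro rfl
  have : cInf C = 0 := by simp [cInf]
  linarith

theorem log_card_nonneg [NeZero n] [NeZero N] : 0 ≤ Real.log ((n : ℝ) ^ 2 * (N : ℝ)) := by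
  have h1 : (1 : ℝ) ≤ n := by exact_mod_cast NeZero.one_le (n := n)
  have h2 : (1 : ℝ) ≤ N := by exact_mod_cast NeZero.one_le (n := N)
  exact Real.log_nonneg (one_le_mul_of_one_le_of_one_le (one_le_pow₀ h1) h2)

theorem iota_nonpos [NeZero n] (hb : b ∈ stdSimplex ℝ (Fin n)) : iota b ≤ 0 := by
  have h0 : b 0 ≤ 1 := by
    rw [← hb.2]; exact Finset.single_le_sum (fun i _ => hb.1 i) (Finset.mem_univ 0)
  exact (ciInf_le (Set.finite_range _).bddBelow 0).trans (Real.log_nonpos (hb.1 0) h0)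

namespace IsData

theorem eta_pos (h : IsData C a b ε θ) : 0 < eta C ε := by
  have := neZero_left_of_cInf_pos h.cInf_pos
  have := neZero_right_of_cInf_pos h.cInf_pos
  have := log_card_nonneg (n := n) (N := N)
  exact lt_min (div_pos h.eps_pos (by positivity)) h.cInf_pos

theorem eta_le (_h : IsData C a b ε θ) : eta C ε ≤ cInf C := min_le_right _ _

theorem eta_mul_iota_nonpos (h : IsData C a b ε θ) : eta C ε * iota b ≤ 0 := by
  have := neZero_left_of_cInf_pos h.cInf_pos
  exact mul_nonpos_of_nonneg_of_nonpos h.eta_pos.le (iota_nonpos h.b_mem)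

theorem lam_mem (h : IsData C a b ε θ) (t : ℕ) :
    (pame C a b ε θ t).lam ∈ simplex N ∧ (pame C a b ε θ t).lamPrev ∈ simplex N := by
  have := neZero_right_of_cInf_pos h.cInf_pos
  have h0 : (WithLp.toLp 2 fun _ => 1 / (N : ℝ) : EuclideanSpace ℝ (Fin N)) ∈ simplex N := by
    refine ⟨fun k => by simp, ?_⟩
    simp
  induction t with
  | zero => exact ⟨h0, h0⟩
  | succ t ih => exact ⟨(projSimplex_spec (NeZero.pos N) _).1, ih.1⟩

theorem g_sub_le (h : IsData C a b ε θ) (t : ℕ) (j l : Fin n) :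
    (pame C a b ε θ t).g j - (pame C a b ε θ t).g l ≤ 2 * cInf C - eta C ε * iota b := by
  have := neZero_left_of_cInf_pos h.cInf_pos
  have := neZero_right_of_cInf_pos h.cInf_pos
  cases t with
  | zero =>
    have := h.eta_mul_iota_nonpos
    have := h.cInf_pos
    simp only [pame, pameInit]
    linarith
  | succ t => exact gUpdate_sub_le h.eta_pos h.b_pos h.b_mem.2 abs_le_cInf (h.lam_mem t).1 j l

end IsData

/-- The violation of the column marginal at iteration `t + 1`. -/
noncomputable def colErr (C : Fin N → Matrix (Fin n) (Fin n) ℝ) (a b : Fin n → ℝ)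
    (ε θ : ℝ) (t : ℕ) : ℝ :=
  l1 (colSum (∑ k, pamePlan C a b ε θ t k) - b)

/-- The length of the last step in `λ` before iteration `t + 1`. -/
noncomputable def lamErr (C : Fin N → Matrix (Fin n) (Fin n) ℝ) (a b : Fin n → ℝ)
    (ε θ : ℝ) (t : ℕ) : ℝ :=
  ‖(pame C a b ε θ t).lam - (pame C a b ε θ t).lamPrev‖

/-- The length of the projected gradient step of iteration `t + 1`. -/
noncomputable def proxErr (C : Fin N → Matrix (Fin n) (Fin n) ℝ) (a b : Fin n → ℝ)
    (ε θ : ℝ) (t : ℕ) : ℝ :=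
  ‖(pame C a b ε θ (t + 1)).lam - (pame C a b ε θ (t + 1)).y‖

/-- The gap between the optimal dual value and the Hamiltonian. -/
noncomputable def hamGap (C : Fin N → Matrix (Fin n) (Fin n) ℝ) (a b : Fin n → ℝ)
    (ε θ : ℝ) (t : ℕ) : ℝ :=
  dualOpt C a b (eta C ε) - hamiltonian C a b ε θ t

theorem lamErr_nonneg (t : ℕ) : 0 ≤ lamErr C a b ε θ t := norm_nonneg _

namespace IsData

theorem lam_succ (h : IsData C a b ε θ) (t : ℕ) :
    (pame C a b ε θ (t + 1)).lam = projSimplex ((pame C a b ε θ (t + 1)).y +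
      (eta C ε / (2 * cInf C ^ 2)) • gradLam C (eta C ε) (pame C a b ε θ (t + 1)).f
        (pame C a b ε θ (t + 1)).g (pame C a b ε θ (t + 1)).y) := by
  have := neZero_left_of_cInf_pos h.cInf_pos
  have := neZero_right_of_cInf_pos h.cInf_pos
  rw [← gradient_dualF (a := a) (b := b) h.eta_pos]
  rfl

theorem norm_lam_sub_y_le (h : IsData C a b ε θ) (t : ℕ) :
    ‖(pame C a b ε θ t).lam - (pame C a b ε θ (t + 1)).y‖ ≤ (1 - θ) * lamErr C a b ε θ t := by
  have := neZero_right_of_cInf_pos h.cInf_pos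
  rw [norm_sub_rev]
  refine (norm_projSimplex_sub_le _ (h.lam_mem t).1).trans ?_
  rw [add_sub_cancel_left, norm_smul, Real.norm_eq_abs, abs_of_pos (by linarith [h.theta_lt])]
  rfl

theorem zetaMass_eq_one (h : IsData C a b ε θ) (t : ℕ) :
    zetaMass C (eta C ε) (pame C a b ε θ (t + 1)).f (pame C a b ε θ t).g
      (pame C a b ε θ t).lam = 1 := by
  have := neZero_left_of_cInf_pos h.cInf_pos
  have := neZero_right_of_cInf_pos h.cInf_pos
  exact zetaMass_fUpdate h.eta_pos h.a_pos h.a_mem.2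

theorem rowSum_pamePlan (h : IsData C a b ε θ) (t : ℕ) :
    rowSum (∑ k, pamePlan C a b ε θ t k) = a := by
  have := neZero_left_of_cInf_pos h.cInf_pos
  have := neZero_right_of_cInf_pos h.cInf_pos
  rw [show pamePlan C a b ε θ t = _ from plan_eq_zeta (h.zetaMass_eq_one t)]
  exact rowSum_zeta_fUpdate h.eta_pos h.a_pos

theorem inner_gradLam_pame_le (h : IsData C a b ε θ) (t : ℕ) {μ : EuclideanSpace ℝ (Fin N)}
    (hμ : μ ∈ simplex N) :
    inner ℝ (gradLam C (eta C ε) (pame C a b ε θ (t + 1)).f (pame C a b ε θ t).g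
      (pame C a b ε θ t).lam) (μ - (pame C a b ε θ t).lam) ≤
      cInf C * colErr C a b ε θ t + cInf C ^ 2 / eta C ε *
        (5 / 2 * ((1 - θ) * lamErr C a b ε θ t) + 4 * proxErr C a b ε θ t) := by
  have := neZero_left_of_cInf_pos h.cInf_pos
  have := neZero_right_of_cInf_pos h.cInf_pos
  have h1 := inner_gradLam_le h.eta_pos h.cInf_pos h.eta_le h.b_pos h.b_mem.2 abs_le_cInf
    (h.zetaMass_eq_one t) (h.lam_mem t).1 (g' := (pame C a b ε θ (t + 1)).g) rfl
    (h.lam_succ t) hμ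
  refine h1.trans ?_
  have h2 := h.norm_lam_sub_y_le t
  have hκ : 0 ≤ cInf C ^ 2 / eta C ε := div_nonneg (sq_nonneg _) h.eta_pos.le
  have h3 : cInf C ^ 2 / eta C ε * (5 / 2 *
      ‖(pame C a b ε θ t).lam - (pame C a b ε θ (t + 1)).y‖ + 4 * proxErr C a b ε θ t) ≤
      cInf C ^ 2 / eta C ε *
        (5 / 2 * ((1 - θ) * lamErr C a b ε θ t) + 4 * proxErr C a b ε θ t) :=
    mul_le_mul_of_nonneg_left (by linarith) hκ
  exact add_le_add le_rfl h3

theorem dualF_le_half_step (h : IsData C a b ε θ) (t : ℕ) :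
    dualF C a b (eta C ε) (pame C a b ε θ t).f (pame C a b ε θ t).g (pame C a b ε θ t).lam ≤
      dualF C a b (eta C ε) (pame C a b ε θ (t + 1)).f (pame C a b ε θ t).g
        (pame C a b ε θ t).lam := by
  have := neZero_left_of_cInf_pos h.cInf_pos
  have := neZero_right_of_cInf_pos h.cInf_pos
  exact le_dualF_fUpdate h.eta_pos h.a_pos h.a_mem.2 _

/-- The penalty weight `1 / (2 τ)` is exactly the coefficient of `‖λ' - λ‖²` in the proximal gain,
so the new penalty cancels that term. -/
theorem inv_two_tau (h : IsData C a b ε θ) (x : ℝ) :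
    x / (2 * tau C ε) = cInf C ^ 2 / eta C ε * x := by
  have := h.eta_pos
  have := h.cInf_pos
  rw [tau]
  field_simp

/-- Increase of the Hamiltonian from the half step `(f^{t+1}, g^t, λ^t)` on. -/
theorem hamiltonian_succ_ge (h : IsData C a b ε θ) (t : ℕ) :
    dualF C a b (eta C ε) (pame C a b ε θ (t + 1)).f (pame C a b ε θ t).g
        (pame C a b ε θ t).lam + eta C ε / 2 * colErr C a b ε θ t ^ 2
        - cInf C ^ 2 / eta C ε * ((1 - θ) * lamErr C a b ε θ t) ^ 2 +
        cInf C ^ 2 / (2 * eta C ε) * proxErr C a b ε θ t ^ 2 ≤ hamiltonian C a b ε θ (t + 1) := by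
  have := neZero_left_of_cInf_pos h.cInf_pos
  have := neZero_right_of_cInf_pos h.cInf_pos
  have h1 : eta C ε / 2 * colErr C a b ε θ t ^ 2 ≤
      dualF C a b (eta C ε) (pame C a b ε θ (t + 1)).f (pame C a b ε θ (t + 1)).g
        (pame C a b ε θ t).lam - dualF C a b (eta C ε) (pame C a b ε θ (t + 1)).f
          (pame C a b ε θ t).g (pame C a b ε θ t).lam :=
    dualF_gUpdate_sub_ge h.eta_pos h.b_pos h.b_mem.2
  have h2 := dualF_prox_sub_ge (a := a) (b := b) h.eta_pos h.cInf_pos abs_le_cInf (h.lam_mem t).1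
    (h.lam_succ t)
  have h3 : ‖(pame C a b ε θ t).lam - (pame C a b ε θ (t + 1)).y‖ ^ 2 ≤
      ((1 - θ) * lamErr C a b ε θ t) ^ 2 :=
    pow_le_pow_left₀ (norm_nonneg _) (h.norm_lam_sub_y_le t) 2
  have hκ : 0 ≤ cInf C ^ 2 / eta C ε := div_nonneg (sq_nonneg _) h.eta_pos.le
  have h4 := mul_le_mul_of_nonneg_left h3 hκ
  rw [mul_sub] at h2
  rw [hamiltonian, h.inv_two_tau]
  change _ ≤ _ - cInf C ^ 2 / eta C ε *
    ‖(pame C a b ε θ (t + 1)).lam - (pame C a b ε θ t).lam‖ ^ 2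
  simp only [proxErr]
  linarith

/-- The old penalty releases `c² / η` times `lamErr²`, of which the extrapolation consumes the
fraction `(1 - θ)²`; what is left is `1 - (1 - θ)² = 2 θ - θ²`. -/
theorem hamGap_sub_ge (h : IsData C a b ε θ) (t : ℕ) :
    eta C ε / 2 * colErr C a b ε θ t ^ 2 +
      cInf C ^ 2 / eta C ε * (2 * θ - θ ^ 2) * lamErr C a b ε θ t ^ 2 +
      cInf C ^ 2 / (2 * eta C ε) * proxErr C a b ε θ t ^ 2 ≤
      hamGap C a b ε θ t - hamGap C a b ε θ (t + 1) := by
  have h1 := h.hamiltonian_succ_ge t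
  have h2 := h.dualF_le_half_step t
  rw [hamGap, hamGap, sub_sub_sub_cancel_left, hamiltonian.eq_1 C a b ε θ t, h.inv_two_tau]
  rw [← lamErr]
  have e : cInf C ^ 2 / eta C ε * ((1 - θ) * lamErr C a b ε θ t) ^ 2 =
    cInf C ^ 2 / eta C ε * lamErr C a b ε θ t ^ 2 -
      cInf C ^ 2 / eta C ε * (2 * θ - θ ^ 2) * lamErr C a b ε θ t ^ 2 := by ring
  linarith

theorem hamGap_succ_le_self (h : IsData C a b ε θ) (t : ℕ) :
    hamGap C a b ε θ (t + 1) ≤ hamGap C a b ε θ t := by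
  have h1 := h.hamGap_sub_ge t
  have := h.eta_pos
  have h2 : 0 ≤ 2 * θ - θ ^ 2 := by nlinarith [h.theta_pos, h.theta_lt]
  have : 0 ≤ eta C ε / 2 * colErr C a b ε θ t ^ 2 +
      cInf C ^ 2 / eta C ε * (2 * θ - θ ^ 2) * lamErr C a b ε θ t ^ 2 +
      cInf C ^ 2 / (2 * eta C ε) * proxErr C a b ε θ t ^ 2 := by positivity
  linarith

theorem dualF_le_dualOpt (h : IsData C a b ε θ) (f g : Fin n → ℝ)
    {lam : EuclideanSpace ℝ (Fin N)} (hlam : lam ∈ simplex N) :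
    dualF C a b (eta C ε) f g lam ≤ dualOpt C a b (eta C ε) :=
  le_csSup (bddAbove_dualValues C a b h.a_mem h.b_mem h.eta_pos) ⟨f, g, lam, hlam, rfl⟩

theorem dualGap_le_hamGap (h : IsData C a b ε θ) (t : ℕ) :
    dualOpt C a b (eta C ε) - dualF C a b (eta C ε) (pame C a b ε θ (t + 1)).f
      (pame C a b ε θ t).g (pame C a b ε θ t).lam ≤ hamGap C a b ε θ t := by
  have h2 := h.dualF_le_half_step t
  have h3 : 0 ≤ cInf C ^ 2 / eta C ε * ‖(pame C a b ε θ t).lam - (pame C a b ε θ t).lamPrev‖ ^ 2 :=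
    mul_nonneg (div_nonneg (sq_nonneg _) h.eta_pos.le) (sq_nonneg _)
  rw [hamGap, hamiltonian, h.inv_two_tau]
  linarith

theorem hamGap_nonneg (h : IsData C a b ε θ) (t : ℕ) : 0 ≤ hamGap C a b ε θ t :=
  (sub_nonneg.2 (h.dualF_le_dualOpt _ _ (h.lam_mem t).1)).trans (h.dualGap_le_hamGap t)

theorem sum_colSum_pamePlan (h : IsData C a b ε θ) (t : ℕ) :
    ∑ j, colSum (∑ k, pamePlan C a b ε θ t k) j = 1 := by
  rw [sum_colSum, ← sum_rowSum, h.rowSum_pamePlan, h.a_mem.2]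

/-- Concavity at the half step removes the row term, because the rows are already correct. The
column term costs the oscillation `2 c_∞ - η ι` of the potentials and the `λ` term one more `c_∞`,
hence the coefficient `3 c_∞ - η ι`. -/
theorem dualGap_le (h : IsData C a b ε θ) (t : ℕ) :
    dualOpt C a b (eta C ε) - dualF C a b (eta C ε) (pame C a b ε θ (t + 1)).f
      (pame C a b ε θ t).g (pame C a b ε θ t).lam ≤
      (3 * cInf C - eta C ε * iota b) * colErr C a b ε θ t + cInf C ^ 2 / eta C ε *
        (5 / 2 * ((1 - θ) * lamErr C a b ε θ t) + 4 * proxErr C a b ε θ t) := by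
  have := neZero_left_of_cInf_pos h.cInf_pos
  have := neZero_right_of_cInf_pos h.cInf_pos
  rw [sub_le_iff_le_add]
  refine csSup_le ⟨_, 0, 0, _, (h.lam_mem t).1, rfl⟩ ?_
  rintro _ ⟨f, g, lam, hlam, rfl⟩
  -- Arbitrary competitors have unbounded `g`; replacing `g` by its update only raises `F` and makes
  -- its oscillation bounded.
  refine (le_dualF_gUpdate (C := C) (a := a) (f := f) (g := g) (lam := lam) h.eta_pos h.b_pos
    h.b_mem.2 g).trans ?_
  rw [← sub_le_iff_le_add]
  refine (dualF_sub_le h.eta_pos).trans ?_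
  rw [dualDeriv, ← inner_gradLam]
  have e1 := h.rowSum_pamePlan t
  simp only [pamePlan] at e1
  rw [e1]
  simp only [sub_self, zero_mul, Finset.sum_const_zero, zero_add]
  have h1 := h.inner_gradLam_pame_le t hlam
  have h2 := sum_mul_le_of_sub_le (R := 2 * cInf C - eta C ε * iota b)
    (v := colSum (∑ k, pamePlan C a b ε θ t k) - b)
    (h := (pame C a b ε θ t).g - gUpdate C b (eta C ε) f g lam) (by
      simp only [Pi.sub_apply, Finset.sum_sub_distrib]
      rw [h.sum_colSum_pamePlan, h.b_mem.2, sub_self]) (by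
      intro j l
      have e2 := h.g_sub_le t j l
      have e3 := gUpdate_sub_le (C := C) (f := f) (g := g) h.eta_pos h.b_pos h.b_mem.2 abs_le_cInf
        hlam l j
      simp only [Pi.sub_apply]
      linarith)
  have e4 : ∀ j, (b j - colSum (∑ k, plan C (eta C ε) (pame C a b ε θ (t + 1)).f
      (pame C a b ε θ t).g (pame C a b ε θ t).lam k) j) *
      (gUpdate C b (eta C ε) f g lam - (pame C a b ε θ t).g) j =
      (colSum (∑ k, pamePlan C a b ε θ t k) - b) j *
        ((pame C a b ε θ t).g - gUpdate C b (eta C ε) f g lam) j := by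
    intro j
    simp only [Pi.sub_apply, pamePlan]
    ring
  simp only [e4]
  rw [← colErr] at h2
  linarith

theorem lamErr_le (h : IsData C a b ε θ) (t : ℕ) : lamErr C a b ε θ t ≤ 3 / 2 :=
  norm_sub_le_of_mem_simplex (h.lam_mem t).1 (h.lam_mem t).2

theorem proxErr_le (h : IsData C a b ε θ) (t : ℕ) : proxErr C a b ε θ t ≤ 3 / 2 := by
  have := neZero_right_of_cInf_pos h.cInf_pos
  exact norm_sub_le_of_mem_simplex (h.lam_mem (t + 1)).1 (projSimplex_spec (NeZero.pos N) _).1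

theorem colErr_le (h : IsData C a b ε θ) (t : ℕ) : colErr C a b ε θ t ≤ 2 := by
  have := neZero_left_of_cInf_pos h.cInf_pos
  have := neZero_right_of_cInf_pos h.cInf_pos
  have h1 : colErr C a b ε θ t ≤ ∑ j, (colSum (∑ k, pamePlan C a b ε θ t k) j + b j) := by
    rw [colErr, l1]
    refine Finset.sum_le_sum fun j _ => ?_
    have e1 : 0 ≤ colSum (∑ k, pamePlan C a b ε θ t k) j := by
      rw [colSum_sum]
      exact Finset.sum_nonneg fun k _ => Finset.sum_nonneg fun i _ => (plan_pos k i j).le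
    have e2 := h.b_pos j
    rw [Pi.sub_apply, abs_le]
    constructor <;> linarith
  rw [Finset.sum_add_distrib, h.sum_colSum_pamePlan, h.b_mem.2] at h1
  linarith

/-- The quadratic loss from extrapolation becomes linear because `(1 - θ) * lamErr` is at most `3 /
2`; together with `5 / 2` from `dualGap_le` this gives the coefficient `4`. -/
theorem hamGap_succ_le (h : IsData C a b ε θ) (t : ℕ) :
    hamGap C a b ε θ (t + 1) ≤
      (3 * cInf C - eta C ε * iota b) * colErr C a b ε θ t + 4 * (cInf C ^ 2 / eta C ε) *
        ((1 - θ) * lamErr C a b ε θ t + proxErr C a b ε θ t) := by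
  have h1 := h.hamiltonian_succ_ge t
  have h2 := h.dualGap_le t
  have h3 := h.lamErr_le t
  have h4 : ((1 - θ) * lamErr C a b ε θ t) ^ 2 ≤ 3 / 2 * ((1 - θ) * lamErr C a b ε θ t) := by
    have e0 := lamErr_nonneg (C := C) (a := a) (b := b) (ε := ε) (θ := θ) t
    have e1 : 0 ≤ (1 - θ) * lamErr C a b ε θ t := mul_nonneg (by linarith [h.theta_lt]) e0
    have e2 : (1 - θ) * lamErr C a b ε θ t ≤ 3 / 2 := by nlinarith [h.theta_pos]
    nlinarith
  have hκ : 0 ≤ cInf C ^ 2 / eta C ε := div_nonneg (sq_nonneg _) h.eta_pos.le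
  have h5 := mul_le_mul_of_nonneg_left h4 hκ
  have h6 : 0 ≤ eta C ε / 2 * colErr C a b ε θ t ^ 2 :=
    mul_nonneg (by linarith [h.eta_pos]) (sq_nonneg _)
  have h7 : 0 ≤ cInf C ^ 2 / (2 * eta C ε) * proxErr C a b ε θ t ^ 2 :=
    mul_nonneg (div_nonneg (sq_nonneg _) (by linarith [h.eta_pos])) (sq_nonneg _)
  rw [hamGap]
  linarith

end IsData

end Progress

end EOT

namespace EOT

/-! ### From quadratic decrease and linear gap to the `1 / t` rate -/

section Rate

/-- Cauchy–Schwarz for two terms; applied twice, it squares the three-term linear bound on the gap.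
-/
theorem sq_add_le_of_sq_le {u v k l q r : ℝ} (hk : 0 ≤ k) (hl : 0 ≤ l) (hq : 0 ≤ q) (hr : 0 ≤ r)
    (hu : u ^ 2 ≤ k * q) (hv : v ^ 2 ≤ l * r) : (u + v) ^ 2 ≤ (k + l) * (q + r) := by
  have h1 : (2 * (u * v)) ^ 2 ≤ (k * r + l * q) ^ 2 := by
    have := mul_le_mul hu hv (sq_nonneg v) (mul_nonneg hk hq)
    nlinarith [sq_nonneg (k * r - l * q)]
  have h2 := abs_le_of_sq_le_sq' h1 (add_nonneg (mul_nonneg hk hr) (mul_nonneg hl hq)) |>.2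
  nlinarith

/-- One step of the recursion that gives the rate `1 / t`. -/
theorem mul_gap_le {c η θ α Γ A B G δ δ' : ℝ} (hc : 0 < c) (hη : 0 < η) (hηc : η ≤ c)
    (hθ : 0 < θ) (hθ1 : θ < 1) (hα : 0 < α) (hαΓ : α ≤ 8 / 7 * Γ) (hcΓ : 7 * c ≤ Γ)
    (hθΓ : (7 - 5 * θ) ^ 2 * c ^ 2 ≤ 2 * (2 * θ - θ ^ 2) * Γ ^ 2)
    (hA2 : A ≤ 2) (hB : 0 ≤ B) (hB2 : B ≤ 3 / 2) (hG2 : G ≤ 3 / 2)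
    (hδ' : 0 ≤ δ')
    (hD : η / 2 * A ^ 2 + c ^ 2 / η * (2 * θ - θ ^ 2) * B ^ 2 + c ^ 2 / (2 * η) * G ^ 2 ≤ δ - δ')
    (hgap : δ' ≤ α * A + 4 * (c ^ 2 / η) * ((1 - θ) * B + G)) :
    η * (δ * δ') ≤ (δ - δ') * (3 * α * Γ + 2 * Γ ^ 2) := by
  have hΓ : 0 < Γ := by linarith
  have h2θ : 0 < 2 * θ - θ ^ 2 := by nlinarith
  have hq : η ^ 2 * A ^ 2 / 2 + c ^ 2 * (2 * θ - θ ^ 2) * B ^ 2 + c ^ 2 * G ^ 2 / 2 ≤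
      η * (δ - δ') := by
    refine le_of_eq_of_le ?_ (mul_le_mul_of_nonneg_left hD hη.le)
    field_simp
  have hu : η * δ' ≤ α * (η * A) + 4 * c ^ 2 * ((1 - θ) * B) + 4 * c ^ 2 * G := by
    refine (mul_le_mul_of_nonneg_left hgap hη.le).trans (le_of_eq ?_)
    field_simp
    ring
  have hcc : 49 * c ^ 2 ≤ Γ ^ 2 := by nlinarith
  have h49 : 49 * (1 - θ) ^ 2 * c ^ 2 ≤ 2 * (2 * θ - θ ^ 2) * Γ ^ 2 := by
    refine le_trans ?_ hθΓ
    refine mul_le_mul_of_nonneg_right ?_ (sq_nonneg c)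
    nlinarith
  have e1 : (α * (η * A)) ^ 2 ≤ (2 * α ^ 2) * (η ^ 2 * A ^ 2 / 2) := by
    apply le_of_eq; ring
  have e2 : (4 * c ^ 2 * ((1 - θ) * B)) ^ 2 ≤
      (32 / 49 * Γ ^ 2) * (c ^ 2 * (2 * θ - θ ^ 2) * B ^ 2) := by
    have := mul_le_mul_of_nonneg_left h49 (show 0 ≤ 16 / 49 * (c ^ 2 * B ^ 2) by positivity)
    linarith
  have e3 : (4 * c ^ 2 * G) ^ 2 ≤ (32 / 49 * Γ ^ 2) * (c ^ 2 * G ^ 2 / 2) := by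
    have := mul_le_mul_of_nonneg_left hcc (show 0 ≤ 16 / 49 * (c ^ 2 * G ^ 2) by positivity)
    linarith
  have e4 := sq_add_le_of_sq_le (by positivity) (by positivity) (by positivity) (by positivity)
    (sq_add_le_of_sq_le (by positivity) (by positivity) (by positivity) (by positivity) e1 e2) e3
  have e5 : (η * δ') ^ 2 ≤ (2 * α ^ 2 + 64 / 49 * Γ ^ 2) * (η * (δ - δ')) := by
    refine (pow_le_pow_left₀ (mul_nonneg hη.le hδ') hu 2).trans (e4.trans ?_)
    have := mul_le_mul_of_nonneg_left hq (show 0 ≤ 2 * α ^ 2 + 64 / 49 * Γ ^ 2 by positivity)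
    linarith
  have hd : 0 ≤ δ - δ' := le_trans (by positivity) hD
  -- A crude bound on the gap from the sizes of the errors, needed for the cross term in `δ * δ' =
  -- δ'² + δ' * (δ - δ')`.
  have e6 : η * δ' ≤ 2 / 7 * (α * Γ) + 12 / 49 * Γ ^ 2 := by
    have f1 : α * (η * A) ≤ α * (Γ / 7 * 2) := by
      refine mul_le_mul_of_nonneg_left ?_ hα.le
      calc η * A ≤ η * 2 := mul_le_mul_of_nonneg_left hA2 hη.le
        _ ≤ Γ / 7 * 2 := by linarith
    have f2 : (1 - θ) * B + G ≤ 3 := by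
      have := mul_nonneg hθ.le hB
      linarith
    have f3 := mul_le_mul_of_nonneg_left f2 (show 0 ≤ 4 * c ^ 2 by positivity)
    linarith
  have e7 : (η * δ') * (η * (δ - δ')) ≤
      (2 / 7 * (α * Γ) + 12 / 49 * Γ ^ 2) * (η * (δ - δ')) :=
    mul_le_mul_of_nonneg_right e6 (mul_nonneg hη.le hd)
  -- With `α ≤ 8 / 7 * Γ` the coefficients are `16 / 7 + 2 / 7 ≤ 3` and `64 / 49 + 12 / 49 ≤ 2`.
  have e8 : 2 * α ^ 2 + 64 / 49 * Γ ^ 2 + (2 / 7 * (α * Γ) + 12 / 49 * Γ ^ 2) ≤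
      3 * α * Γ + 2 * Γ ^ 2 := by
    have := mul_le_mul_of_nonneg_left hαΓ hα.le
    have := mul_pos hα hΓ
    have := sq_nonneg Γ
    linarith
  have e9 := mul_le_mul_of_nonneg_right e8 (mul_nonneg hη.le hd)
  have e10 : η * (η * (δ * δ')) ≤ η * ((δ - δ') * (3 * α * Γ + 2 * Γ ^ 2)) := by
    have : η * (η * (δ * δ')) = (η * δ') ^ 2 + (η * δ') * (η * (δ - δ')) := by ring
    rw [this]
    refine (add_le_add e5 e7).trans ?_
    rw [← add_mul]
    exact e9.trans_eq (by ring)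
  exact le_of_mul_le_mul_left e10 hη

/-- Morally `1 / δ (t + 1) ≥ 1 / δ t + 1 / W`, written without inverting so that vanishing gaps are
allowed. If `δ 0 = 0`, the convention `W / 0 = 0` is the intended reading. -/
theorem mul_add_div_le_of_recursion {δ : ℕ → ℝ} {W : ℝ} (hW : 0 < W) (hδ : ∀ t, 0 ≤ δ t)
    (hanti : ∀ t, δ (t + 1) ≤ δ t)
    (hrec : ∀ t, δ t * δ (t + 1) ≤ (δ t - δ (t + 1)) * W) (t : ℕ) :
    δ t * (t + W / δ 0) ≤ W := by
  induction t with
  | zero =>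
    by_cases h0 : δ 0 = 0
    · simp [h0, hW.le]
    · field_simp
      simp
  | succ t ih =>
    rcases (hδ t).eq_or_lt with h0 | h0
    · have : δ (t + 1) = 0 := le_antisymm (h0 ▸ hanti t) (hδ _)
      rw [this, zero_mul]; exact hW.le
    · have h1 := mul_le_mul_of_nonneg_left ih (hδ (t + 1))
      have h2 := hrec t
      refine le_of_mul_le_mul_left ?_ h0
      push_cast
      linarith

/-- A nonnegative decreasing sequence of rate `W / t` makes fewer than `e / D` decrements of size
`D` once it is below `e`. -/
theorem exists_le_of_recursion {δ : ℕ → ℝ} {W e D : ℝ} {P : ℕ → Prop} (hW : 0 < W) (he : 0 < e)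
    (hD : 0 < D) (hδ : ∀ t, 0 ≤ δ t) (hanti : ∀ t, δ (t + 1) ≤ δ t)
    (hrec : ∀ t, δ t * δ (t + 1) ≤ (δ t - δ (t + 1)) * W)
    (hP : ∀ t, δ t ≤ e → ¬ P t → D ≤ δ t - δ (t + 1)) :
    ∃ t : ℕ, (t : ℝ) + 1 ≤ W / e + e / D + 2 ∧ P t := by
  by_contra hcon
  push Not at hcon
  -- By the rate, the sequence is below `e` from this index on. If `P` then fails for `⌊e / D⌋₊ + 1`
  -- consecutive indices, the sequence becomes negative.
  set t₀ := ⌈W / e⌉₊ with ht₀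
  have hWe : 0 < W / e := div_pos hW he
  have ht₀1 : W / e ≤ t₀ := Nat.le_ceil _
  have ht₀2 : (t₀ : ℝ) < W / e + 1 := Nat.ceil_lt_add_one hWe.le
  have hsmall : δ t₀ ≤ e := by
    have h1 := mul_add_div_le_of_recursion hW hδ hanti hrec t₀
    have h2 : 0 ≤ δ t₀ * (W / δ 0) := mul_nonneg (hδ _) (div_nonneg hW.le (hδ 0))
    have h3 : δ t₀ * (W / e) ≤ δ t₀ * t₀ := mul_le_mul_of_nonneg_left ht₀1 (hδ _)
    have h4 : δ t₀ * (W / e) ≤ e * (W / e) := by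
      rw [mul_div_cancel₀ _ he.ne']
      linarith
    exact le_of_mul_le_mul_right h4 hWe
  have hfloor : ((⌊e / D⌋₊ : ℕ) : ℝ) ≤ e / D := Nat.floor_le (div_pos he hD).le
  have hdec : ∀ m : ℕ, m ≤ ⌊e / D⌋₊ + 1 → δ (t₀ + m) ≤ e - m * D := by
    intro m
    induction m with
    | zero => intro _; simpa using hsmall
    | succ m ih =>
      intro hm
      have h1 := ih (by omega)
      have hm' : (m : ℝ) ≤ ⌊e / D⌋₊ := by exact_mod_cast (by omega : m ≤ ⌊e / D⌋₊)
      have h2 := hcon (t₀ + m) (by push_cast; linarith)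
      have h3 := hP (t₀ + m) (h1.trans (sub_le_self _ (mul_nonneg (Nat.cast_nonneg _) hD.le))) h2
      rw [← add_assoc]
      push_cast
      linarith
  have h1 := hdec _ le_rfl
  have h2 := hδ (t₀ + (⌊e / D⌋₊ + 1))
  have h3 := Nat.lt_floor_add_one (e / D)
  rw [div_lt_iff₀ hD] at h3
  push_cast at h1
  linarith

/-! ### The role of `γ₁` and the iteration count -/

variable {n N : ℕ} {C : Fin N → Matrix (Fin n) (Fin n) ℝ} {a b : Fin n → ℝ} {ε θ : ℝ}

/-- `1 / √γ₁`. -/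
noncomputable def gammaRoot (C : Fin N → Matrix (Fin n) (Fin n) ℝ) (b : Fin n → ℝ)
    (ε θ : ℝ) : ℝ :=
  (Real.sqrt (gamma1 C b ε θ))⁻¹

namespace IsData

theorem two_theta_pos (h : IsData C a b ε θ) : 0 < 2 * θ - θ ^ 2 := by
  nlinarith [h.theta_pos, h.theta_lt]

theorem osc_pos (h : IsData C a b ε θ) : 0 < 2 * cInf C - eta C ε * iota b := by
  linarith [h.eta_mul_iota_nonpos, h.cInf_pos]

theorem gamma1_pos (h : IsData C a b ε θ) : 0 < gamma1 C b ε θ := by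
  have h1 := h.osc_pos
  have h2 := h.two_theta_pos
  have h3 := h.cInf_pos
  have h4 : 0 < 7 - 5 * θ := by linarith [h.theta_lt]
  refine lt_min (by positivity) (lt_min (by positivity) (by positivity))

theorem gammaRoot_pos (h : IsData C a b ε θ) : 0 < gammaRoot C b ε θ :=
  inv_pos.2 (Real.sqrt_pos.2 h.gamma1_pos)

theorem gammaRoot_sq (h : IsData C a b ε θ) : gammaRoot C b ε θ ^ 2 = 1 / gamma1 C b ε θ := by
  rw [gammaRoot, inv_pow, Real.sq_sqrt h.gamma1_pos.le, one_div]

theorem le_gammaRoot_sq (h : IsData C a b ε θ) {x y : ℝ} (hy : 0 < y)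
    (hle : gamma1 C b ε θ ≤ x / y) : y ≤ x * gammaRoot C b ε θ ^ 2 := by
  rw [h.gammaRoot_sq, mul_one_div, le_div_iff₀ h.gamma1_pos]
  rw [le_div_iff₀ hy] at hle
  linarith

theorem osc_le_gammaRoot (h : IsData C a b ε θ) :
    2 * cInf C - eta C ε * iota b ≤ gammaRoot C b ε θ := by
  have h1 := h.le_gammaRoot_sq (pow_pos h.osc_pos 2) (min_le_left _ _)
  rw [one_mul] at h1
  exact le_of_sq_le_sq h1 h.gammaRoot_pos.le

theorem seven_cInf_le_gammaRoot (h : IsData C a b ε θ) : 7 * cInf C ≤ gammaRoot C b ε θ := by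
  have hc := h.cInf_pos
  have h1 := h.le_gammaRoot_sq (y := 49 * cInf C ^ 2) (by positivity)
    ((min_le_right _ _).trans (min_le_right _ _))
  refine le_of_sq_le_sq ?_ h.gammaRoot_pos.le
  linarith

theorem theta_mul_cInf_le (h : IsData C a b ε θ) : (7 - 5 * θ) ^ 2 * cInf C ^ 2 ≤
    2 * (2 * θ - θ ^ 2) * gammaRoot C b ε θ ^ 2 := by
  have h2 := h.two_theta_pos
  have h3 := h.cInf_pos
  have h4 : 0 < 7 - 5 * θ := by linarith [h.theta_lt]
  exact h.le_gammaRoot_sq (by positivity)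
    ((min_le_right _ _).trans (min_le_left _ _))

/-- The constant of the rate of the Hamiltonian. -/
noncomputable def rateConst (C : Fin N → Matrix (Fin n) (Fin n) ℝ) (b : Fin n → ℝ)
    (ε θ : ℝ) : ℝ :=
  (3 * (3 * cInf C - eta C ε * iota b) * gammaRoot C b ε θ + 2 * gammaRoot C b ε θ ^ 2) /
    eta C ε

theorem rateConst_pos (h : IsData C a b ε θ) : 0 < rateConst C b ε θ := by
  have h1 := h.gammaRoot_pos
  have h2 : 0 < 3 * cInf C - eta C ε * iota b := by linarith [h.osc_pos, h.cInf_pos]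
  have h3 := h.eta_pos
  rw [rateConst]
  positivity

/-- Since `3 c_∞ - η ι ≤ (8 / 7) Γ` for `Γ = 1 / √γ₁`, the numerator is at most `(24 / 7 + 2) Γ² ≤ 6
Γ²`. -/
theorem rateConst_le (h : IsData C a b ε θ) :
    rateConst C b ε θ ≤ 6 / (eta C ε * gamma1 C b ε θ) := by
  have h1 := h.gammaRoot_pos
  have h2 := h.osc_le_gammaRoot
  have h3 := h.seven_cInf_le_gammaRoot
  have e : 6 / (eta C ε * gamma1 C b ε θ) = 6 * gammaRoot C b ε θ ^ 2 / eta C ε := by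
    rw [h.gammaRoot_sq]
    have := h.gamma1_pos
    have := h.eta_pos
    field_simp
  rw [e, rateConst]
  refine div_le_div_of_nonneg_right ?_ h.eta_pos.le
  nlinarith

theorem hamGap_mul_le (h : IsData C a b ε θ) (t : ℕ) :
    hamGap C a b ε θ t * hamGap C a b ε θ (t + 1) ≤
      (hamGap C a b ε θ t - hamGap C a b ε θ (t + 1)) * rateConst C b ε θ := by
  have h2 := h.osc_le_gammaRoot
  have h3 := h.seven_cInf_le_gammaRoot
  have h1 := mul_gap_le (α := 3 * cInf C - eta C ε * iota b) h.cInf_pos h.eta_pos h.eta_le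
    h.theta_pos h.theta_lt (by linarith [h.osc_pos, h.cInf_pos])
    (by linarith) h3 h.theta_mul_cInf_le (h.colErr_le t)
    (lamErr_nonneg t) (h.lamErr_le t) (h.proxErr_le t) (h.hamGap_nonneg (t + 1))
    (h.hamGap_sub_ge t) (h.hamGap_succ_le t)
  rw [rateConst, ← mul_div_assoc, le_div_iff₀ h.eta_pos, mul_comm]
  exact h1

theorem hamGap_succ_le_rate (h : IsData C a b ε θ) (t : ℕ) :
    hamGap C a b ε θ (t + 1) ≤ 6 / (eta C ε * gamma1 C b ε θ) /
      ((t : ℝ) + 1 + 6 / (eta C ε * gamma1 C b ε θ * hamGap C a b ε θ 0)) := by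
  have hW : 0 < 6 / (eta C ε * gamma1 C b ε θ) :=
    div_pos (by norm_num) (mul_pos h.eta_pos h.gamma1_pos)
  have h1 := mul_add_div_le_of_recursion hW h.hamGap_nonneg h.hamGap_succ_le_self
    (fun t => (h.hamGap_mul_le t).trans (mul_le_mul_of_nonneg_left h.rateConst_le
      (sub_nonneg.2 (h.hamGap_succ_le_self t)))) (t + 1)
  rw [div_div] at h1
  have h2 : 0 ≤ 6 / (eta C ε * gamma1 C b ε θ * hamGap C a b ε θ 0) := by
    rw [← div_div]
    exact div_nonneg hW.le (h.hamGap_nonneg 0)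
  rw [le_div_iff₀ (by positivity)]
  push_cast at h1
  exact h1

theorem pameStop_iff (t : ℕ) : PAMEStop C a b ε θ t ↔
    colErr C a b ε θ t ≤ ε / (6 * (6 * cInf C - eta C ε * iota b)) ∧
    lamErr C a b ε θ t ≤ eta C ε * ε / (60 * (1 - θ) * cInf C ^ 2) ∧
    proxErr C a b ε θ t ≤ eta C ε * ε / (42 * cInf C ^ 2) ∧
    dualOpt C a b (eta C ε) - dualF C a b (eta C ε) (pame C a b ε θ (t + 1)).f
      (pame C a b ε θ t).g (pame C a b ε θ t).lam ≤ ε / 6 := Iff.rfl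

/-- A small Hamiltonian gap forces the fourth condition, so one of the three errors exceeds its
threshold and its square alone accounts for the decrease. With `r = 6 c_∞ - η ι ≤ (11 / 7) Γ`, the
column case needs `72 * 11 / 7 ≤ 114`, the `λ` case `2 * 3600 / 49 ≤ 147`, and the proximal case
`3528 / 49 ≤ 147`. -/
theorem decrease_of_not_pameStop (h : IsData C a b ε θ) {t : ℕ} (hgap : hamGap C a b ε θ t ≤ ε / 6)
    (hS : ¬ PAMEStop C a b ε θ t) :
    eta C ε * ε ^ 2 / (114 * (6 * cInf C - eta C ε * iota b) * gammaRoot C b ε θ +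
      147 * gammaRoot C b ε θ ^ 2) ≤ hamGap C a b ε θ t - hamGap C a b ε θ (t + 1) := by
  have hc := h.cInf_pos
  have hη := h.eta_pos
  have hε := h.eps_pos
  have hΓ := h.gammaRoot_pos
  have h2θ := h.two_theta_pos
  have h1θ : 0 < 1 - θ := by linarith [h.theta_lt]
  have hr : 0 < 6 * cInf C - eta C ε * iota b := by linarith [h.osc_pos]
  have hr2 : 6 * cInf C - eta C ε * iota b ≤ 11 / 7 * gammaRoot C b ε θ := by
    linarith [h.osc_le_gammaRoot, h.seven_cInf_le_gammaRoot]
  have hcc : 49 * cInf C ^ 2 ≤ gammaRoot C b ε θ ^ 2 := by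
    have := pow_le_pow_left₀ (by positivity) h.seven_cInf_le_gammaRoot 2
    linarith
  have hθΓ := h.theta_mul_cInf_le
  have hD := h.hamGap_sub_ge t
  set r := 6 * cInf C - eta C ε * iota b
  set Γ := gammaRoot C b ε θ
  set c := cInf C
  set η := eta C ε
  have hQ : 0 < 114 * r * Γ + 147 * Γ ^ 2 := by positivity
  have hA0 : 0 ≤ η / 2 * colErr C a b ε θ t ^ 2 := by positivity
  have hB0 : 0 ≤ c ^ 2 / η * (2 * θ - θ ^ 2) * lamErr C a b ε θ t ^ 2 := by positivity
  have hG0 : 0 ≤ c ^ 2 / (2 * η) * proxErr C a b ε θ t ^ 2 := by positivity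
  have hgap' := (h.dualGap_le_hamGap t).trans hgap
  rw [pameStop_iff] at hS
  by_cases hA : colErr C a b ε θ t ≤ ε / (6 * r)
  · by_cases hB : lamErr C a b ε θ t ≤ η * ε / (60 * (1 - θ) * c ^ 2)
    · have hG : η * ε / (42 * c ^ 2) ≤ proxErr C a b ε θ t := by
        by_contra hcon
        exact hS ⟨hA, hB, (not_le.1 hcon).le, hgap'⟩
      have h1 := mul_le_mul_of_nonneg_left (pow_le_pow_left₀ (by positivity) hG 2)
        (show 0 ≤ c ^ 2 / (2 * η) by positivity)
      have h2 : η * ε ^ 2 / (114 * r * Γ + 147 * Γ ^ 2) ≤ η * ε ^ 2 / (3528 * c ^ 2) :=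
        div_le_div_of_nonneg_left (by positivity) (by positivity) (by nlinarith [mul_pos hr hΓ])
      have h3 : c ^ 2 / (2 * η) * (η * ε / (42 * c ^ 2)) ^ 2 = η * ε ^ 2 / (3528 * c ^ 2) := by
        field_simp
        norm_num
      linarith
    · have h1 := mul_le_mul_of_nonneg_left (pow_le_pow_left₀ (by positivity) (not_le.1 hB).le 2)
        (show 0 ≤ c ^ 2 / η * (2 * θ - θ ^ 2) by positivity)
      have h3 : c ^ 2 / η * (2 * θ - θ ^ 2) * (η * ε / (60 * (1 - θ) * c ^ 2)) ^ 2 =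
          η * ε ^ 2 * (2 * θ - θ ^ 2) / (3600 * (1 - θ) ^ 2 * c ^ 2) := by
        field_simp
        norm_num
      have h2 : η * ε ^ 2 / (114 * r * Γ + 147 * Γ ^ 2) ≤
          η * ε ^ 2 * (2 * θ - θ ^ 2) / (3600 * (1 - θ) ^ 2 * c ^ 2) := by
        rw [div_le_div_iff₀ hQ (by positivity), mul_assoc (η * ε ^ 2)]
        refine mul_le_mul_of_nonneg_left ?_ (by positivity)
        have e1 : 49 * (1 - θ) ^ 2 * c ^ 2 ≤ (7 - 5 * θ) ^ 2 * c ^ 2 := by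
          refine mul_le_mul_of_nonneg_right ?_ (sq_nonneg c)
          nlinarith [h.theta_pos, h.theta_lt]
        have e2 : 0 ≤ (2 * θ - θ ^ 2) * (114 * r * Γ) := by positivity
        have e3 : 0 ≤ (1 - θ) ^ 2 * c ^ 2 := by positivity
        linarith
      linarith
  · have h1 := mul_le_mul_of_nonneg_left (pow_le_pow_left₀ (by positivity) (not_le.1 hA).le 2)
      (show 0 ≤ η / 2 by positivity)
    have h2 : η * ε ^ 2 / (114 * r * Γ + 147 * Γ ^ 2) ≤ η * ε ^ 2 / (72 * r ^ 2) :=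
      div_le_div_of_nonneg_left (by positivity) (by positivity)
        (by nlinarith [mul_pos hr hΓ, mul_le_mul_of_nonneg_left hr2 hr.le])
    have h3 : η / 2 * (ε / (6 * r)) ^ 2 = η * ε ^ 2 / (72 * r ^ 2) := by
      field_simp
      norm_num
    linarith

theorem iterBound_eq (h : IsData C a b ε θ) : iterBound C b ε θ =
    8 + (48 * (6 * cInf C - eta C ε * iota b) * gammaRoot C b ε θ +
      (3600 * (1 - θ) ^ 2 + 882) * cInf C ^ 2 + 48 * gammaRoot C b ε θ ^ 2) /
        (eta C ε * ε) := by
  have hη := h.eta_pos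
  have hε := h.eps_pos
  have hγ := h.gamma1_pos
  have hsq := Real.sqrt_pos.2 hγ
  have hr : 0 < 6 * cInf C - eta C ε * iota b := by linarith [h.osc_pos, h.cInf_pos]
  rw [h.gammaRoot_sq, iterBound, gammaRoot, epsPrime]
  field_simp
  ring

theorem exists_pameStop (h : IsData C a b ε θ) :
    ∃ t : ℕ, (t : ℝ) + 1 ≤ iterBound C b ε θ ∧ PAMEStop C a b ε θ t := by
  have hη := h.eta_pos
  have hε := h.eps_pos
  have hΓ := h.gammaRoot_pos
  have hc := h.cInf_pos
  have hr : 0 < 6 * cInf C - eta C ε * iota b := by linarith [h.osc_pos]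
  obtain ⟨t, ht, hs⟩ := exists_le_of_recursion h.rateConst_pos (e := ε / 6) (by positivity)
    (D := eta C ε * ε ^ 2 / (114 * (6 * cInf C - eta C ε * iota b) * gammaRoot C b ε θ +
      147 * gammaRoot C b ε θ ^ 2)) (by positivity) h.hamGap_nonneg h.hamGap_succ_le_self
      h.hamGap_mul_le (fun t => h.decrease_of_not_pameStop (t := t))
  refine ⟨t, ht.trans ?_, hs⟩
  rw [h.iterBound_eq]
  have e : rateConst C b ε θ / (ε / 6) + ε / 6 / (eta C ε * ε ^ 2 /
      (114 * (6 * cInf C - eta C ε * iota b) * gammaRoot C b ε θ +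
      147 * gammaRoot C b ε θ ^ 2)) =
      (18 * (3 * cInf C - eta C ε * iota b) * gammaRoot C b ε θ + 12 * gammaRoot C b ε θ ^ 2 +
      (114 * (6 * cInf C - eta C ε * iota b) * gammaRoot C b ε θ +
      147 * gammaRoot C b ε θ ^ 2) / 6) / (eta C ε * ε) := by
    rw [rateConst]
    field_simp
    ring
  rw [e]
  -- Reaching level `ε / 6` contributes `18` and `12`, the steps below it `114 / 6 = 19` and `147 /
  -- 6`; both totals stay below `48`.
  have h1 : (18 * (3 * cInf C - eta C ε * iota b) * gammaRoot C b ε θ +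
      12 * gammaRoot C b ε θ ^ 2 +
      (114 * (6 * cInf C - eta C ε * iota b) * gammaRoot C b ε θ +
      147 * gammaRoot C b ε θ ^ 2) / 6) / (eta C ε * ε) ≤
      (48 * (6 * cInf C - eta C ε * iota b) * gammaRoot C b ε θ +
      (3600 * (1 - θ) ^ 2 + 882) * cInf C ^ 2 + 48 * gammaRoot C b ε θ ^ 2) /
        (eta C ε * ε) := by
    refine div_le_div_of_nonneg_right ?_ (by positivity)
    have e1 : 0 ≤ (3600 * (1 - θ) ^ 2 + 882) * cInf C ^ 2 := by positivity
    have e2 := mul_pos hr hΓ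
    have e3 := mul_pos hc hΓ
    nlinarith
  linarith

theorem gamma1_le (h : IsData C a b ε θ) : gamma1 C b ε θ ≤ (1 / 49) / cInf C ^ 2 := by
  refine ((min_le_right _ _).trans (min_le_right _ _)).trans (le_of_eq ?_)
  have := h.cInf_pos
  field_simp

/-- With `η ≤ c_∞`, every entry of the minimum defining `γ₁` is at least a constant multiple of `1 /
c_∞²`. -/
theorem gammaRoot_sq_le (h : IsData C a b ε θ) {M : ℝ} (hM1 : (2 - iota b) ^ 2 ≤ M)
    (hM2 : (7 - 5 * θ) ^ 2 / (2 * (2 * θ - θ ^ 2)) ≤ M) (hM3 : 49 ≤ M) :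
    gammaRoot C b ε θ ^ 2 ≤ M * cInf C ^ 2 := by
  have := neZero_left_of_cInf_pos h.cInf_pos
  have hc := h.cInf_pos
  have h2 := h.two_theta_pos
  have h4 : 0 < 7 - 5 * θ := by linarith [h.theta_lt]
  have hM : 0 < M := by linarith
  have key : 1 / (M * cInf C ^ 2) ≤ gamma1 C b ε θ := by
    refine le_min ?_ (le_min ?_ ?_)
    · refine one_div_le_one_div_of_le (pow_pos h.osc_pos 2) ?_
      have e1 : 2 * cInf C - eta C ε * iota b ≤ (2 - iota b) * cInf C := by
        nlinarith [h.eta_le, iota_nonpos h.b_mem]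
      calc _ ≤ ((2 - iota b) * cInf C) ^ 2 := pow_le_pow_left₀ h.osc_pos.le e1 2
        _ = (2 - iota b) ^ 2 * cInf C ^ 2 := by ring
        _ ≤ _ := mul_le_mul_of_nonneg_right hM1 (sq_nonneg _)
    · rw [div_le_div_iff₀ (by positivity) (by positivity), one_mul]
      rw [div_le_iff₀ (by positivity)] at hM2
      have := mul_le_mul_of_nonneg_right hM2 (sq_nonneg (cInf C))
      linarith
    · exact one_div_le_one_div_of_le (by positivity)
        (mul_le_mul_of_nonneg_right hM3 (sq_nonneg _))
  rw [h.gammaRoot_sq, div_le_iff₀ h.gamma1_pos]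
  rwa [div_le_iff₀ (by positivity), mul_comm] at key

end IsData

theorem exists_iterBound_le (n N : ℕ) (b : Fin n → ℝ) (θ : ℝ) :
    ∃ K : ℝ, 1 / 49 ≤ K ∧ ∀ (C : Fin N → Matrix (Fin n) (Fin n) ℝ) (a : Fin n → ℝ) (ε : ℝ),
      IsData C a b ε θ → ε ≤ cInf C → iterBound C b ε θ ≤ K * cInf C ^ 2 / ε ^ 2 := by
  set M := max ((2 - iota b) ^ 2) (max ((7 - 5 * θ) ^ 2 / (2 * (2 * θ - θ ^ 2))) 49) with hM
  set L := 3 * (Real.log ((n : ℝ) ^ 2 * (N : ℝ)) + 1) with hL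
  have hM1 : (2 - iota b) ^ 2 ≤ M := le_max_left _ _
  have hM2 : (7 - 5 * θ) ^ 2 / (2 * (2 * θ - θ ^ 2)) ≤ M :=
    (le_max_left _ _).trans (le_max_right _ _)
  have hM3 : 49 ≤ M := (le_max_right _ _).trans (le_max_right _ _)
  -- `L` comes from `η = ε / L`, `M` from `1 / γ₁ ≤ M c_∞²`, and `4482 = 3600 + 882` covers all `θ`.
  -- The additive `8` is absorbed because `c_∞² / ε² ≥ 1`.
  refine ⟨8 + |L * (48 * (6 - iota b) * M + 4482 + 48 * M)|, by
    have := abs_nonneg (L * (48 * (6 - iota b) * M + 4482 + 48 * M)); linarith, ?_⟩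
  intro C a ε h hεc
  have := neZero_left_of_cInf_pos h.cInf_pos
  have := neZero_right_of_cInf_pos h.cInf_pos
  have hc := h.cInf_pos
  have hε := h.eps_pos
  have hL3 : 3 ≤ L := by
    have := log_card_nonneg (n := n) (N := N)
    linarith
  -- For `ε ≤ c_∞` the first entry of the minimum defining `η` is active, as `L ≥ 3`.
  have hη : eta C ε = ε / L := by
    rw [eta, min_eq_left]
    rw [div_le_iff₀ (by linarith)]
    nlinarith
  have hΓ2 := h.gammaRoot_sq_le hM1 hM2 hM3
  have hΓ : gammaRoot C b ε θ ≤ M * cInf C := by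
    refine le_of_sq_le_sq (hΓ2.trans ?_) (by positivity)
    rw [mul_pow]
    refine mul_le_mul_of_nonneg_right ?_ (sq_nonneg _)
    nlinarith
  have hr : 6 * cInf C - eta C ε * iota b ≤ (6 - iota b) * cInf C := by
    nlinarith [h.eta_le, iota_nonpos h.b_mem]
  have hr0 : 0 < 6 * cInf C - eta C ε * iota b := by linarith [h.osc_pos]
  have h1 : (6 * cInf C - eta C ε * iota b) * gammaRoot C b ε θ ≤
      (6 - iota b) * cInf C * (M * cInf C) :=
    mul_le_mul hr hΓ h.gammaRoot_pos.le (hr0.le.trans hr)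
  have h2 : (3600 * (1 - θ) ^ 2 + 882) * cInf C ^ 2 ≤ 4482 * cInf C ^ 2 := by
    refine mul_le_mul_of_nonneg_right ?_ (sq_nonneg _)
    nlinarith [h.theta_pos, h.theta_lt]
  have h3 : (48 * (6 * cInf C - eta C ε * iota b) * gammaRoot C b ε θ +
      (3600 * (1 - θ) ^ 2 + 882) * cInf C ^ 2 + 48 * gammaRoot C b ε θ ^ 2) /
        (eta C ε * ε) ≤ ((48 * (6 - iota b) * M + 4482 + 48 * M) * cInf C ^ 2) /
          (eta C ε * ε) := by
    refine div_le_div_of_nonneg_right ?_ (mul_pos h.eta_pos hε).le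
    linarith
  have h4 : ((48 * (6 - iota b) * M + 4482 + 48 * M) * cInf C ^ 2) / (eta C ε * ε) =
      L * (48 * (6 - iota b) * M + 4482 + 48 * M) * (cInf C ^ 2 / ε ^ 2) := by
    rw [hη]
    have : L ≠ 0 := by linarith
    field_simp
  have h5 : 1 ≤ cInf C ^ 2 / ε ^ 2 := by
    rw [one_le_div (by positivity)]
    exact pow_le_pow_left₀ hε.le hεc 2
  have h6 := mul_le_mul_of_nonneg_right
    (le_abs_self (L * (48 * (6 - iota b) * M + 4482 + 48 * M))) (zero_le_one.trans h5)
  rw [h.iterBound_eq, mul_div_assoc, add_mul (8 : ℝ)]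
  exact add_le_add (by linarith) ((h3.trans_eq h4).trans h6)

end Rate

end EOT

namespace EOT

/-! ### Margins, rounding and the saddle gap -/

section Rounding

variable {n N : ℕ} {C : Fin N → Matrix (Fin n) (Fin n) ℝ} {a b : Fin n → ℝ} {ε θ η : ℝ}

theorem sum_abs_eq_abs_sum {ι : Type*} [Fintype ι] {x : ι → ℝ} (hx : ∀ k l, 0 ≤ x k * x l) :
    ∑ k, |x k| = |∑ k, x k| := by
  by_cases h : ∀ k, 0 ≤ x k
  · rw [abs_of_nonneg (Finset.sum_nonneg fun k _ => h k)]
    exact Finset.sum_congr rfl fun k _ => abs_of_nonneg (h k)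
  · push Not at h
    obtain ⟨l, hl⟩ := h
    have h' : ∀ k, x k ≤ 0 := fun k => by
      by_contra hk
      push Not at hk
      have := hx k l
      nlinarith [mul_pos_of_neg_of_neg hl (neg_neg_of_pos hk)]
    rw [abs_of_nonpos (Finset.sum_nonpos fun k _ => h' k), ← Finset.sum_neg_distrib]
    exact Finset.sum_congr rfl fun k _ => abs_of_nonpos (h' k)

/-- In overfull columns the surplus `em` is taken from the plans in proportion to their share; plan
`k` thereby loses `s k`. The deficits `ep` of the other columns, of the same total `E`, are refilled
in the proportions `s k / E`, which restores the mass of each plan. No column is both overfull and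
deficient, hence the sign condition. -/
theorem exists_isMargins {P : Fin N → Matrix (Fin n) (Fin n) ℝ} (hP : ∀ k i j, 0 ≤ P k i j)
    (hcol : ∀ j, 0 < colSum (∑ k, P k) j) (hb : ∀ j, 0 ≤ b j)
    (hsum : ∑ j, colSum (∑ k, P k) j = ∑ j, b j) : ∃ A B, IsMargins P b A B := by
  set T := colSum (∑ k, P k) with hT
  set S : Fin N → Fin n → ℝ := fun k => colSum (P k) with hS
  have hS0 : ∀ k j, 0 ≤ S k j := fun k j => Finset.sum_nonneg fun i _ => hP k i j
  have hST : ∀ j, ∑ k, S k j = T j := fun j => (colSum_sum P j).symm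
  set ep : Fin n → ℝ := fun j => max (b j - T j) 0 with hep
  set em : Fin n → ℝ := fun j => max (T j - b j) 0 with hem
  have hep0 : ∀ j, 0 ≤ ep j := fun j => le_max_right _ _
  have hem0 : ∀ j, 0 ≤ em j := fun j => le_max_right _ _
  have hdiff : ∀ j, ep j - em j = b j - T j := by
    intro j
    simp only [hep, hem]
    rcases le_total (b j) (T j) with h | h
    · rw [max_eq_right (by linarith), max_eq_left (by linarith)]; ring
    · rw [max_eq_left (by linarith), max_eq_right (by linarith)]; ring
  have hprod : ∀ j, ep j = 0 ∨ em j = 0 := by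
    intro j
    rcases le_total (b j) (T j) with h | h
    · exact Or.inl (max_eq_right (by linarith))
    · exact Or.inr (max_eq_right (by linarith))
  have hemT : ∀ j, em j ≤ T j := fun j => max_le (by linarith [hb j]) (hcol j).le
  set E := ∑ j, em j with hE
  have hEp : ∑ j, ep j = E := by
    have : ∑ j, (ep j - em j) = 0 := by
      simp_rw [hdiff]
      rw [Finset.sum_sub_distrib, hsum, sub_self]
    rw [Finset.sum_sub_distrib] at this
    linarith
  set s : Fin N → ℝ := fun k => ∑ j, em j * (S k j / T j) with hs
  have hs0 : ∀ k, 0 ≤ s k := fun k => Finset.sum_nonneg fun j _ =>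
    mul_nonneg (hem0 j) (div_nonneg (hS0 k j) (hcol j).le)
  have hsE : ∑ k, s k = E := by
    simp only [hs]
    rw [Finset.sum_comm]
    refine Finset.sum_congr rfl fun j _ => ?_
    rw [← Finset.mul_sum, ← Finset.sum_div, hST, div_self (hcol j).ne', mul_one]
  have hE0 : 0 ≤ E := Finset.sum_nonneg fun j _ => hem0 j
  -- If `E = 0`, the quotient is `0` by convention, and `s k` vanishes as well.
  have hEs : ∀ k, E * (s k / E) = s k := by
    intro k
    by_cases h : E = 0
    · have : s k ≤ 0 := by
        rw [← h, ← hsE]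
        exact Finset.single_le_sum (fun k _ => hs0 k) (Finset.mem_univ k)
      rw [h, zero_mul]
      exact le_antisymm (hs0 k) this
    · exact mul_div_cancel₀ _ h
  have hEe : ∀ j, ep j * (E / E) = ep j := by
    intro j
    by_cases h : E = 0
    · have : ep j ≤ 0 := by
        rw [← h, ← hEp]
        exact Finset.single_le_sum (fun k _ => hep0 k) (Finset.mem_univ j)
      rw [h, div_zero, mul_zero]
      exact le_antisymm (hep0 j) this
    · rw [div_self h, mul_one]
  refine ⟨fun k => rowSum (P k),
    fun k j => S k j - em j * (S k j / T j) + ep j * (s k / E), fun k => rfl, ?_, ?_, ?_, ?_⟩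
  · intro k j
    have h1 : em j * (S k j / T j) ≤ T j * (S k j / T j) :=
      mul_le_mul_of_nonneg_right (hemT j) (div_nonneg (hS0 k j) (hcol j).le)
    rw [mul_div_cancel₀ _ (hcol j).ne'] at h1
    have h2 := mul_nonneg (hep0 j) (div_nonneg (hs0 k) hE0)
    linarith
  · intro j
    rw [Finset.sum_add_distrib, Finset.sum_sub_distrib, ← Finset.mul_sum, ← Finset.mul_sum,
      ← Finset.sum_div, ← Finset.sum_div, hST, hsE, hEe, div_self (hcol j).ne']
    linarith [hdiff j]
  · intro k
    rw [Finset.sum_add_distrib, Finset.sum_sub_distrib, ← Finset.sum_mul, hEp, hEs, sum_rowSum,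
      ← sum_colSum]
    simp only [hs, hS]
    ring
  · intro j k k'
    change 0 ≤ (S k j - em j * (S k j / T j) + ep j * (s k / E) - S k j) *
      (S k' j - em j * (S k' j / T j) + ep j * (s k' / E) - S k' j)
    rcases hprod j with h | h
    · rw [h]
      have h1 := mul_nonneg (hem0 j) (div_nonneg (hS0 k j) (hcol j).le)
      have h2 := mul_nonneg (hem0 j) (div_nonneg (hS0 k' j) (hcol j).le)
      have := mul_nonneg h1 h2
      linarith
    · rw [h]
      have h1 := mul_nonneg (hep0 j) (div_nonneg (hs0 k) hE0)
      have h2 := mul_nonneg (hep0 j) (div_nonneg (hs0 k') hE0)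
      have := mul_nonneg h1 h2
      linarith

/-- Rounding a positive matrix that already has the row margin. -/
theorem round_spec {P : Matrix (Fin n) (Fin n) ℝ} {B : Fin n → ℝ} [NeZero n]
    (hP : ∀ i j, 0 < P i j) (hB : ∀ j, 0 ≤ B j) (hsum : ∑ i, rowSum P i = ∑ j, B j) :
    rowSum (round P (rowSum P) B) = rowSum P ∧ colSum (round P (rowSum P) B) = B ∧
      (∀ i j, 0 ≤ round P (rowSum P) B i j) ∧
      ∑ i, ∑ j, |round P (rowSum P) B i j - P i j| ≤ l1 (B - colSum P) := by
  have hrow : ∀ i, 0 < rowSum P i := fun i =>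
    Finset.sum_pos (fun j _ => hP i j) Finset.univ_nonempty
  have hcol : ∀ j, 0 < colSum P j := fun j =>
    Finset.sum_pos (fun i _ => hP i j) Finset.univ_nonempty
  have hrr : roundRows P (rowSum P) = P := by
    rw [roundRows]
    have : (fun i => min (rowSum P i / rowSum P i) 1) = fun _ => (1 : ℝ) := by
      ext i
      rw [div_self (hrow i).ne', min_self]
    rw [this, Matrix.diagonal_one, one_mul]
  set D := roundCols P B with hD
  set y : Fin n → ℝ := fun j => min (B j / colSum P j) 1 with hy
  have hy0 : ∀ j, 0 ≤ y j := fun j => le_min (div_nonneg (hB j) (hcol j).le) zero_le_one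
  have hy1 : ∀ j, y j ≤ 1 := fun j => min_le_right _ _
  have hDe : ∀ i j, D i j = P i j * y j := fun i j => by
    rw [hD, roundCols, Matrix.mul_diagonal]
  have hDcol : ∀ j, colSum D j = min (B j) (colSum P j) := by
    intro j
    simp only [colSum, hDe]
    rw [← Finset.sum_mul]
    change colSum P j * y j = _
    rw [hy, mul_min_of_nonneg _ _ (hcol j).le, mul_div_cancel₀ _ (hcol j).ne', mul_one]
    rfl
  set eA := rowSum P - rowSum D with heA
  set eB := B - colSum D with heB
  have heA0 : ∀ i, 0 ≤ eA i := by
    intro i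
    rw [heA, Pi.sub_apply, sub_nonneg]
    refine Finset.sum_le_sum fun j _ => ?_
    rw [hDe]
    exact mul_le_of_le_one_right (hP i j).le (hy1 j)
  have heB0 : ∀ j, 0 ≤ eB j := by
    intro j
    rw [heB, Pi.sub_apply, sub_nonneg, hDcol]
    exact min_le_left _ _
  have hl1A : l1 eA = ∑ i, eA i := Finset.sum_congr rfl fun i _ => abs_of_nonneg (heA0 i)
  have hAB : ∑ i, eA i = ∑ j, eB j := by
    simp only [heA, heB, Pi.sub_apply, Finset.sum_sub_distrib]
    rw [hsum, sum_colSum, sum_rowSum]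
  have hr : round P (rowSum P) B = D + (l1 eA)⁻¹ • Matrix.vecMulVec eA eB := by
    rw [round, hrr]
  have hre : ∀ i j, round P (rowSum P) B i j = D i j + (l1 eA)⁻¹ * (eA i * eB j) := by
    intro i j
    rw [hr]; rfl
  -- The row and column errors are nonnegative with equal sums, so both vanish in the degenerate
  -- case where the inverse is `0`.
  have hcorr : ∀ i, (l1 eA)⁻¹ * (eA i * ∑ j, eB j) = eA i := by
    intro i
    rw [← hAB, hl1A]
    by_cases h : ∑ i, eA i = 0
    · have : eA i ≤ 0 := by
        rw [← h]; exact Finset.single_le_sum (fun i _ => heA0 i) (Finset.mem_univ i)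
      rw [h, inv_zero, zero_mul]
      exact le_antisymm (heA0 i) this
    · field_simp
  have hcorr' : ∀ j, (l1 eA)⁻¹ * ((∑ i, eA i) * eB j) = eB j := by
    intro j
    rw [hl1A]
    by_cases h : ∑ i, eA i = 0
    · have : eB j ≤ 0 := by
        rw [← h, hAB]; exact Finset.single_le_sum (fun i _ => heB0 i) (Finset.mem_univ j)
      rw [h, inv_zero, zero_mul]
      exact le_antisymm (heB0 j) this
    · field_simp
  have hl10 : 0 ≤ (l1 eA)⁻¹ := inv_nonneg.2 (l1_nonneg _)
  refine ⟨?_, ?_, ?_, ?_⟩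
  · ext i
    simp only [rowSum, hre, Finset.sum_add_distrib, ← Finset.mul_sum]
    rw [hcorr, heA]
    simp only [Pi.sub_apply, rowSum]
    ring
  · ext j
    simp only [colSum, hre, Finset.sum_add_distrib, ← Finset.mul_sum, ← Finset.sum_mul]
    rw [hcorr', heB]
    simp only [Pi.sub_apply, colSum]
    ring
  · intro i j
    rw [hre, hDe]
    exact add_nonneg (mul_nonneg (hP i j).le (hy0 j))
      (mul_nonneg hl10 (mul_nonneg (heA0 i) (heB0 j)))
  · calc ∑ i, ∑ j, |round P (rowSum P) B i j - P i j|
        ≤ ∑ i, ∑ j, ((P i j - D i j) + (l1 eA)⁻¹ * (eA i * eB j)) := by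
          refine Finset.sum_le_sum fun i _ => Finset.sum_le_sum fun j _ => ?_
          have e1 : 0 ≤ P i j - D i j := by
            rw [hDe, sub_nonneg]
            exact mul_le_of_le_one_right (hP i j).le (hy1 j)
          have e2 : 0 ≤ (l1 eA)⁻¹ * (eA i * eB j) :=
            mul_nonneg hl10 (mul_nonneg (heA0 i) (heB0 j))
          rw [hre, abs_le]
          constructor <;> linarith
      -- Mass removed by column scaling plus mass added by the correction; in each column only one
      -- of the two is nonzero.
      _ = ∑ j, (colSum P j - colSum D j) + ∑ j, eB j := by
          have e : ∑ i, ∑ j, (l1 eA)⁻¹ * (eA i * eB j) = ∑ j, eB j := by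
            rw [← hAB]
            exact Finset.sum_congr rfl fun i _ => by
              rw [← Finset.mul_sum, ← Finset.mul_sum, hcorr]
          rw [← e]
          simp_rw [Finset.sum_add_distrib, Finset.sum_sub_distrib]
          rw [sum_colSum, sum_colSum]
      _ = l1 (B - colSum P) := by
          rw [← Finset.sum_add_distrib, l1]
          refine Finset.sum_congr rfl fun j _ => ?_
          simp only [heB, Pi.sub_apply, hDcol]
          rcases le_total (B j) (colSum P j) with h | h
          · rw [min_eq_left h, abs_of_nonpos (by linarith)]; ring
          · rw [min_eq_right h, abs_of_nonneg (by linarith)]; ring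

theorem ell_sub_le {P Q : Fin N → Matrix (Fin n) (Fin n) ℝ} {c : ℝ}
    (hC : ∀ k i j, |C k i j| ≤ c) {μ : EuclideanSpace ℝ (Fin N)} (hμ : μ ∈ simplex N) :
    ell C Q μ - ell C P μ ≤ c * ∑ k, ∑ i, ∑ j, |Q k i j - P k i j| := by
  rw [ell, ell, ← Finset.sum_sub_distrib, Finset.mul_sum]
  refine Finset.sum_le_sum fun k _ => ?_
  simp only [frob, Finset.mul_sum, ← Finset.sum_sub_distrib]
  refine Finset.sum_le_sum fun i _ => Finset.sum_le_sum fun j _ => ?_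
  have e : μ k * (Q k i j * C k i j) - μ k * (P k i j * C k i j) =
    (μ k * C k i j) * (Q k i j - P k i j) := by ring
  rw [e]
  refine (le_abs_self _).trans ?_
  rw [abs_mul, abs_mul, abs_of_nonneg (hμ.1 k)]
  refine mul_le_mul_of_nonneg_right ?_ (abs_nonneg _)
  calc μ k * |C k i j| ≤ 1 * c := mul_le_mul (simplex_le_one hμ k) (hC k i j) (abs_nonneg _)
        zero_le_one
    _ = c := one_mul c

theorem isCompact_simplex : IsCompact (simplex N) := by
  have h := (isCompact_stdSimplex ℝ (Fin N)).image (PiLp.continuous_toLp 2 fun _ : Fin N => ℝ)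
  convert h using 1
  ext y
  constructor
  · intro hy
    exact ⟨fun k => y k, hy, rfl⟩
  · rintro ⟨z, hz, rfl⟩
    exact hz

theorem isCompact_couplings (ha1 : ∀ i, a i ≤ 1) : IsCompact (couplings N a b) := by
  have hK : IsCompact (Set.pi Set.univ fun _ : Fin N => Set.pi Set.univ fun _ : Fin n =>
      Set.pi Set.univ fun _ : Fin n => Set.Icc (0 : ℝ) 1) :=
    isCompact_univ_pi fun _ => isCompact_univ_pi fun _ => isCompact_univ_pi fun _ => isCompact_Icc
  have hclosed : IsClosed (couplings N a b) := by
    have e : couplings N a b = {π | rowSum (∑ k, π k) = a} ∩ ({π | colSum (∑ k, π k) = b} ∩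
        ⋂ k, ⋂ i, ⋂ j, {π | 0 ≤ π k i j}) := by
      ext π
      simp [couplings]
    rw [e]
    refine IsClosed.inter ?_ (IsClosed.inter ?_ ?_)
    · refine isClosed_eq ?_ continuous_const
      refine continuous_pi fun i => ?_
      simp only [rowSum, Matrix.sum_apply]
      fun_prop
    · refine isClosed_eq ?_ continuous_const
      refine continuous_pi fun i => ?_
      simp only [colSum, Matrix.sum_apply]
      fun_prop
    · exact isClosed_iInter fun k => isClosed_iInter fun i => isClosed_iInter fun j =>
        isClosed_le continuous_const (by fun_prop)
  refine IsCompact.of_isClosed_subset hK hclosed ?_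
  rintro π ⟨hr, -, h0⟩ k - i - j -
  refine ⟨h0 k i j, ?_⟩
  have h1 : π k i j ≤ rowSum (π k) i :=
    Finset.single_le_sum (f := fun j => π k i j) (fun j _ => h0 k i j) (Finset.mem_univ j)
  have h2 : rowSum (π k) i ≤ ∑ k, rowSum (π k) i :=
    Finset.single_le_sum (f := fun k => rowSum (π k) i)
      (fun k _ => Finset.sum_nonneg fun j _ => h0 k i j) (Finset.mem_univ k)
  rw [← rowSum_sum, hr] at h2
  linarith [ha1 i]

theorem continuous_ell_left (lam : EuclideanSpace ℝ (Fin N)) :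
    Continuous fun π => ell C π lam := by
  simp only [ell, frob]
  fun_prop

theorem continuous_ell_right (π : Fin N → Matrix (Fin n) (Fin n) ℝ) :
    Continuous fun μ => ell C π μ := by
  simp only [ell, frob]
  fun_prop

variable {f g : Fin n → ℝ} {lam : EuclideanSpace ℝ (Fin N)}

theorem ell_plan_sub (μ : EuclideanSpace ℝ (Fin N)) :
    ell C (plan C η f g lam) μ - ell C (plan C η f g lam) lam =
      inner ℝ (gradLam C η f g lam) (μ - lam) := by
  rw [inner_gradLam, ell, ell, ← Finset.sum_sub_distrib]
  exact Finset.sum_congr rfl fun k _ => by rw [PiLp.sub_apply]; ring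

/-- Mass `1` forces every entry of `ζ` to be at most `1`, that is `f i + g j ≤ λ k * C k i j`: the
potentials are feasible for the transport dual at fixed `λ`, and this is weak duality. -/
theorem le_ell_of_mem_couplings (hη : 0 < η) (hmass : zetaMass C η f g lam = 1)
    {ρ : Fin N → Matrix (Fin n) (Fin n) ℝ} (hρ : ρ ∈ couplings N a b) :
    ∑ i, a i * f i + ∑ j, b j * g j ≤ ell C ρ lam := by
  obtain ⟨hr, hc, h0⟩ := hρ
  rw [← hr, ← hc, ← sum_sum_sum_mul_row, ← sum_sum_sum_mul_col, ell]
  simp only [← Finset.sum_add_distrib, frob, Finset.mul_sum]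
  refine Finset.sum_le_sum fun k _ => Finset.sum_le_sum fun i _ => Finset.sum_le_sum fun j _ => ?_
  have h1 : zeta C η f g lam k i j ≤ 1 := by
    rw [← hmass, zetaMass_eq, ← sum_prod3 (fun k i j => zeta C η f g lam k i j)]
    exact Finset.single_le_sum
      (f := fun m : Fin N × Fin n × Fin n => zeta C η f g lam m.1 m.2.1 m.2.2)
      (fun m _ => (zeta_pos _ _ _).le) (Finset.mem_univ (k, i, j))
  simp only [zeta, Matrix.of_apply, Real.exp_le_one_iff] at h1
  have h2 : f i + g j - lam k * C k i j ≤ 0 := by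
    by_contra hcon
    push Not at hcon
    exact absurd h1 (not_le.2 (div_pos hcon hη))
  have := mul_nonneg (h0 k i j) (neg_nonneg.2 h2)
  linarith

/-- At mass `1` the cost `λ k * C k i j` equals `f i + g j` minus `η` times the log of the plan. The
excess is therefore `η` times the entropy of a weight on `n² N` points, bounded by Jensen. -/
theorem ell_plan_le [NeZero n] [NeZero N] (hη : 0 < η) (hmass : zetaMass C η f g lam = 1) :
    ell C (plan C η f g lam) lam ≤ ∑ i, rowSum (∑ k, plan C η f g lam k) i * f i +
      ∑ j, colSum (∑ k, plan C η f g lam k) j * g j + η * Real.log ((n : ℝ) ^ 2 * (N : ℝ)) := by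
  have h1 := exp_sum_mul_le_sum_mul_exp (p := planWeight C η f g lam)
    (x := fun m => - Real.log (planWeight C η f g lam m)) (fun m => (planWeight_pos m).le)
    sum_planWeight
  have h2 : ∀ m, planWeight C η f g lam m * Real.exp (- Real.log (planWeight C η f g lam m)) = 1 :=
    fun m => by
      rw [Real.exp_neg, Real.exp_log (planWeight_pos m), mul_inv_cancel₀ (planWeight_pos m).ne']
  simp only [h2, Finset.sum_const, Finset.card_univ, Fintype.card_prod, Fintype.card_fin,
    nsmul_eq_mul, mul_one] at h1
  have hn : (0 : ℝ) < n := by exact_mod_cast NeZero.pos n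
  have hN : (0 : ℝ) < N := by exact_mod_cast NeZero.pos N
  push_cast at h1
  rw [show (N : ℝ) * (n * n) = (n : ℝ) ^ 2 * N by ring,
    ← Real.le_log_iff_exp_le (by positivity)] at h1
  have h3 : ∑ m, planWeight C η f g lam m * -Real.log (planWeight C η f g lam m) =
      - ∑ m, planWeight C η f g lam m * expoDiff C η f g lam m := by
    rw [← Finset.sum_neg_distrib]
    refine Finset.sum_congr rfl fun m _ => ?_
    rw [planWeight, plan_eq_zeta hmass]
    simp only [zeta, Matrix.of_apply, Real.log_exp, expoDiff]
    ring
  rw [h3, sum_planWeight_mul_expoDiff, ← neg_div, div_le_iff₀ hη] at h1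
  rw [ell]
  linarith

namespace IsData

theorem pamePlan_pos (h : IsData C a b ε θ) (t : ℕ) (k : Fin N) (i j : Fin n) :
    0 < pamePlan C a b ε θ t k i j := by
  have := neZero_left_of_cInf_pos h.cInf_pos
  have := neZero_right_of_cInf_pos h.cInf_pos
  exact plan_pos k i j

theorem exists_isMargins_pamePlan (h : IsData C a b ε θ) (t : ℕ) :
    ∃ A B, IsMargins (pamePlan C a b ε θ t) b A B := by
  have := neZero_left_of_cInf_pos h.cInf_pos
  have := neZero_right_of_cInf_pos h.cInf_pos
  refine exists_isMargins (fun k i j => (h.pamePlan_pos t k i j).le) (fun j => ?_)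
    (fun j => (h.b_pos j).le) ?_
  · rw [colSum_sum]
    exact Finset.sum_pos (fun k _ => Finset.sum_pos (fun i _ => h.pamePlan_pos t k i j)
      Finset.univ_nonempty) Finset.univ_nonempty
  · rw [h.sum_colSum_pamePlan, h.b_mem.2]

/-- The gap passes through the half-step plan `P`: from `Q` to `P` at `μ`, from `μ` to `λ` at `P`,
then to `ρ` through the potentials. The four contributions `ε / 12`, `ε / 24`, `2 ε / 21` and `ε /
3` sum to less than `ε`. -/
theorem saddle_gap_le (h : IsData C a b ε θ) {t : ℕ} (hS : PAMEStop C a b ε θ t)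
    {μ : EuclideanSpace ℝ (Fin N)} (hμ : μ ∈ simplex N)
    {Q ρ : Fin N → Matrix (Fin n) (Fin n) ℝ} (hρ : ρ ∈ couplings N a b)
    (hQ : ∑ k, ∑ i, ∑ j, |Q k i j - pamePlan C a b ε θ t k i j| ≤ colErr C a b ε θ t) :
    ell C Q μ - ell C ρ (pame C a b ε θ t).lam ≤ ε := by
  have := neZero_left_of_cInf_pos h.cInf_pos
  have := neZero_right_of_cInf_pos h.cInf_pos
  have hc := h.cInf_pos
  have hη := h.eta_pos
  have hε := h.eps_pos
  have h1θ : 0 < 1 - θ := by linarith [h.theta_lt]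
  obtain ⟨hA, hB, hG, -⟩ := (pameStop_iff t).1 hS
  have h1 := (ell_sub_le (C := C) abs_le_cInf hμ (P := pamePlan C a b ε θ t) (Q := Q)).trans
    (mul_le_mul_of_nonneg_left hQ hc.le)
  have h2 := (ell_plan_sub μ).trans_le (h.inner_gradLam_pame_le t hμ)
  have h3 := ell_plan_le hη (h.zetaMass_eq_one t)
  have h4 := le_ell_of_mem_couplings hη (h.zetaMass_eq_one t) hρ
  have h5 := sum_mul_le_of_sub_le (R := (2 * cInf C - eta C ε * iota b) / 2)
    (v := colSum (∑ k, pamePlan C a b ε θ t k) - b) (h := (pame C a b ε θ t).g) (by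
      simp only [Pi.sub_apply, Finset.sum_sub_distrib]
      rw [h.sum_colSum_pamePlan, h.b_mem.2, sub_self]) (fun j l => by
      have := h.g_sub_le t j l
      linarith)
  rw [← colErr] at h5
  simp only [Pi.sub_apply, sub_mul, Finset.sum_sub_distrib] at h5
  change ell C (pamePlan C a b ε θ t) μ - ell C (pamePlan C a b ε θ t) _ ≤ _ at h2
  change ell C (pamePlan C a b ε θ t) _ ≤ ∑ i, rowSum (∑ k, pamePlan C a b ε θ t k) i * _ +
    ∑ j, colSum (∑ k, pamePlan C a b ε θ t k) j * _ + _ at h3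
  rw [h.rowSum_pamePlan] at h3
  have hr : 0 < 6 * cInf C - eta C ε * iota b := by linarith [h.osc_pos]
  -- The coefficient collects `c_∞` from rounding, `c_∞` from the gap in `λ`, and `(2 c_∞ - η ι) /
  -- 2` from the mismatch of the columns paired with `g`.
  have e1 : (6 * cInf C - eta C ε * iota b) / 2 * colErr C a b ε θ t ≤ ε / 12 := by
    refine (mul_le_mul_of_nonneg_left hA (by positivity)).trans (le_of_eq ?_)
    field_simp
    norm_num
  have hκ : 0 ≤ cInf C ^ 2 / eta C ε := by positivity
  have e2 : cInf C ^ 2 / eta C ε * (5 / 2 * ((1 - θ) * lamErr C a b ε θ t)) ≤ ε / 24 := by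
    have := mul_le_mul_of_nonneg_left hB (show 0 ≤ cInf C ^ 2 / eta C ε * (5 / 2 * (1 - θ)) by
      positivity)
    calc _ = cInf C ^ 2 / eta C ε * (5 / 2 * (1 - θ)) * lamErr C a b ε θ t := by ring
      _ ≤ _ := this
      _ = ε / 24 := by field_simp; norm_num
  have e3 : cInf C ^ 2 / eta C ε * (4 * proxErr C a b ε θ t) ≤ 2 * ε / 21 := by
    have := mul_le_mul_of_nonneg_left hG (show 0 ≤ cInf C ^ 2 / eta C ε * 4 by positivity)
    calc _ = cInf C ^ 2 / eta C ε * 4 * proxErr C a b ε θ t := by ring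
      _ ≤ _ := this
      _ = 2 * ε / 21 := by field_simp; norm_num
  have e4 : eta C ε * Real.log ((n : ℝ) ^ 2 * (N : ℝ)) ≤ ε / 3 := by
    have hl := log_card_nonneg (n := n) (N := N)
    have h6 : eta C ε ≤ ε / (3 * (Real.log ((n : ℝ) ^ 2 * (N : ℝ)) + 1)) := min_le_left _ _
    rw [le_div_iff₀ (by positivity)] at h6
    linarith
  rw [mul_add] at h2
  linarith

theorem isEpsOptimal_round (h : IsData C a b ε θ) {t : ℕ} (hS : PAMEStop C a b ε θ t)
    {A B : Fin N → Fin n → ℝ} (hAB : IsMargins (pamePlan C a b ε θ t) b A B) :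
    IsEpsOptimal C a b ε (fun k => round (pamePlan C a b ε θ t k) (A k) (B k))
      (pame C a b ε θ t).lam := by
  have := neZero_left_of_cInf_pos h.cInf_pos
  have := neZero_right_of_cInf_pos h.cInf_pos
  obtain ⟨hA, hB0, hBb, hsum, hsign⟩ := hAB
  have hspec := fun k => round_spec (P := pamePlan C a b ε θ t k) (B := B k)
    (h.pamePlan_pos t k) (hB0 k) (by rw [← hA]; exact hsum k)
  simp only [← hA] at hspec
  set Q : Fin N → Matrix (Fin n) (Fin n) ℝ :=
    fun k => round (pamePlan C a b ε θ t k) (A k) (B k) with hQ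
  have hmem : Q ∈ couplings N a b := by
    refine ⟨?_, ?_, fun k => (hspec k).2.2.1⟩
    · ext i
      rw [rowSum_sum, ← h.rowSum_pamePlan t, rowSum_sum]
      exact Finset.sum_congr rfl fun k _ => by rw [(hspec k).1, hA]
    · ext j
      rw [colSum_sum, ← hBb j]
      exact Finset.sum_congr rfl fun k _ => by rw [(hspec k).2.1]
  have hclose : ∑ k, ∑ i, ∑ j, |Q k i j - pamePlan C a b ε θ t k i j| ≤ colErr C a b ε θ t := by
    refine (Finset.sum_le_sum fun k _ => (hspec k).2.2.2).trans (le_of_eq ?_)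
    simp only [l1]
    rw [Finset.sum_comm, colErr, l1]
    refine Finset.sum_congr rfl fun j _ => ?_
    simp only [Pi.sub_apply]
    -- The common sign in each column makes the `N` rounding errors add up to the aggregate column
    -- error rather than exceed it.
    rw [sum_abs_eq_abs_sum fun k l => hsign j k l, Finset.sum_sub_distrib, hBb, ← colSum_sum,
      abs_sub_comm]
  have ha1 : ∀ i, a i ≤ 1 := fun i => by
    rw [← h.a_mem.2]
    exact Finset.single_le_sum (fun i _ => h.a_mem.1 i) (Finset.mem_univ i)
  have hlam := (h.lam_mem t).1
  obtain ⟨M, hM⟩ := (isCompact_simplex.image (continuous_ell_right (C := C) Q)).exists_isGreatest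
    ⟨_, Set.mem_image_of_mem _ hlam⟩
  obtain ⟨m, hm⟩ := ((isCompact_couplings (N := N) (b := b) ha1).image
    (continuous_ell_left (C := C) (pame C a b ε θ t).lam)).exists_isLeast
    ⟨_, Set.mem_image_of_mem _ hmem⟩
  refine ⟨hmem, hlam, M, m, hM, hm, ?_⟩
  obtain ⟨μ, hμ, rfl⟩ := hM.1
  obtain ⟨ρ, hρ, rfl⟩ := hm.1
  exact h.saddle_gap_le hS hμ hρ hclose

end IsData

end Rounding

end EOT

/-- `K` is chosen before `C`, `a` and `ε`. As `λ⁰ = λ⁻¹`, the Hamiltonian at `0` is the initial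
value of `F`, and division by zero gives the stated reading when the initial gap vanishes. -/
theorem mainTheorem2 {n N : ℕ} (b : Fin n → ℝ) (hb : b ∈ stdSimplex ℝ (Fin n))
    (hb_pos : ∀ j, 0 < b j) (θ : ℝ) (hθ_pos : 0 < θ) (hθ_lt : θ < 1) :
    ∃ K : ℝ, ∀ (C : Fin N → Matrix (Fin n) (Fin n) ℝ) (a : Fin n → ℝ) (ε : ℝ),
      a ∈ stdSimplex ℝ (Fin n) → (∀ i, 0 < a i) → 0 < EOT.cInf C → 0 < ε →
      -- the orders of magnitude of `γ₁` and of the iteration bound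
      EOT.gamma1 C b ε θ ≤ K / EOT.cInf C ^ 2 ∧
      (ε ≤ EOT.cInf C → EOT.iterBound C b ε θ ≤ K * EOT.cInf C ^ 2 / ε ^ 2) ∧
      -- some iteration `T = t + 1` within the bound meets the stopping conditions
      (∃ t : ℕ, (t : ℝ) + 1 ≤ EOT.iterBound C b ε θ ∧ EOT.PAMEStop C a b ε θ t) ∧
      -- at every iteration that meets them, rounding gives an `ε`-optimal solution
      (∀ t : ℕ, EOT.PAMEStop C a b ε θ t →
        (∃ A B, EOT.IsMargins (EOT.pamePlan C a b ε θ t) b A B) ∧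
        ∀ A B, EOT.IsMargins (EOT.pamePlan C a b ε θ t) b A B →
          EOT.IsEpsOptimal C a b ε
            (fun k => EOT.round (EOT.pamePlan C a b ε θ t k) (A k) (B k))
            (EOT.pame C a b ε θ t).lam) ∧
      -- the Hamiltonian is nondecreasing, with gap of order `1 / t`
      (∀ t : ℕ, EOT.hamiltonian C a b ε θ t ≤ EOT.hamiltonian C a b ε θ (t + 1)) ∧
      (∀ t : ℕ, EOT.dualOpt C a b (EOT.eta C ε) - EOT.hamiltonian C a b ε θ (t + 1) ≤
        6 / (EOT.eta C ε * EOT.gamma1 C b ε θ) /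
          ((t : ℝ) + 1 + 6 / (EOT.eta C ε * EOT.gamma1 C b ε θ *
            (EOT.dualOpt C a b (EOT.eta C ε) - EOT.hamiltonian C a b ε θ 0)))) := by
  obtain ⟨K, hK, hbound⟩ := EOT.exists_iterBound_le n N b θ
  refine ⟨K, fun C a ε ha ha_pos hc hε => ?_⟩
  have h : EOT.IsData C a b ε θ := ⟨ha, ha_pos, hb, hb_pos, hc, hε, hθ_pos, hθ_lt⟩
  refine ⟨h.gamma1_le.trans (div_le_div_of_nonneg_right hK (sq_nonneg _)),
    hbound C a ε h, h.exists_pameStop,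
    fun t ht => ⟨h.exists_isMargins_pamePlan t, fun A B hAB => h.isEpsOptimal_round ht hAB⟩,
    fun t => ?_, h.hamGap_succ_le_rate⟩
  have := h.hamGap_succ_le_self t
  rw [EOT.hamGap, EOT.hamGap] at this
  linarith
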